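/- Let $n\ge 1$, $V=\mathbb R^n$ with coordinates $x^1,\dots,x^n$, and let $u_{x^{i_1}\cdots x^{i_k}}$ be the standard coordinates on the jet spaces of functions $u$ on $V$. Put $\lambda_i=u_{x^i}$, let $D_i$ be the total derivatives, and let $\partial_{\lambda_i}=\sum_j (h^{-1})^{ji}D_j$ with $h=(u_{x^ix^j})$. The group $\mathrm{Aff}(V)$ acts on functions by $u\mapsto u\circ g^{-1}$ and hence, by prolongation, on jets. Let $\mathcal A$ be the algebra of functions on jets (of arbitrary finite order) that do not depend on $u$ itself, are smooth in $x\in V$ and rational in the derivatives of $u$: quotients $P/Q$ of polynomials in the $u_{x^{i_1}\cdots x^{i_k}}$, $k\ge1$, with coefficients in $C^\infty(V)$, where $Q$ vanishes identically on no fibre over a point of $V$. A differential invariant is an element of $\mathcal A$ that is constant on $\mathrm{Aff}(V)$-orbits (wherever defined). The moments are $m_\emptyset=1$, $m_{i\tau}=x^i m_\tau+\partial_{\lambda_i}m_\tau$ (that is, $m_\tau=Z_{\lambda_\tau}/Z$ with $Z=e^{-H}$ and $H=u-\lambda_ix^i$). The $k$-th central moment is the symmetric form $$\sigma_k=\sum_{i=0}^k(-1)^{k-i}\binom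 ki\, m_i\odot m_1^{\otimes(k-i)},\qquad m_i=m_{j_1\cdots j_i}\,d\lambda_{j_1}\otimes\cdots\otimes d\lambda_{j_i},$$ regarded as a horizontal symmetric $k$-form, with $d\lambda_i=\sum_j u_{x^ix^j}dx^j$. Let $v_1$ be the horizontal vector field with $\sigma_2(v_1,\cdot)=\lambda_i\,dx^i$, let $A$ be the endomorphism with $\sigma_2(Aw,w')=\sigma_3(v_1,w,w')$, and put $v_i=A^{i-1}v_1$ for $i=1,\dots,n$. A horizontal vector field $\sum_j w^jD_j$ acts on $\mathcal A$ as a derivation. **Theorem.** The derivations $v_1,\dots,v_n$ are $\mathrm{Aff}(V)$-invariant (they commute with pull-back by every $g\in\mathrm{Aff}(V)$), and the differential invariants are generated by $v_1,\dots,v_n$ and the finitely many functions $\sigma_2(v_1,v_1)$, $\sigma_3(v_i,v_j,v_k)$, $\sigma_4(v_i,v_j,v_k,v_l)$ ($1\le i,j,k,l\le n$) in the following sense. 1. The set of all differential invariants is the smallest real subalgebra of $\mathcal A$ that contains these functions, is closed under $v_1,\dots,v_n$, and is closed under inverses (of elements invertible in $\mathcal A$). 2. The algebra of those differential invariants that are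 polynomial in the derivatives of $u$ of order greater than $3$ (that is, of the form $P/Q$ as above with $Q$ involving only derivatives of order at most $3$) is the smallest real subalgebra of $\mathcal A$ that is closed under $v_1,\dots,v_n$ and contains all $\sigma_4(v_i,v_j,v_k,v_l)$ and all rational functions of $\sigma_2(v_1,v_1)$ and the $\sigma_3(v_i,v_j,v_k)$, that is, the smallest real subalgebra containing the latter functions and closed under inverses of elements invertible in $\mathcal A$. In particular, every differential invariant that is rational in the derivatives of order at most $2$ and polynomial in those of higher order is so generated. -/

import Mathlib

open scoped ContDiff

noncomputable section

namespace AffInv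

/-- The smooth real functions on `V = ℝⁿ`, as a subalgebra of all functions. -/
def smoothSubalgebra (n : ℕ) : Subalgebra ℝ ((Fin n → ℝ) → ℝ) where
  carrier := {f | ContDiff ℝ ∞ f}
  mul_mem' {f g} hf hg := by
    have hf' : ContDiff ℝ ∞ f := hf
    have hg' : ContDiff ℝ ∞ g := hg
    exact hf'.mul hg'
  add_mem' {f g} hf hg := by
    have hf' : ContDiff ℝ ∞ f := hf
    have hg' : ContDiff ℝ ∞ g := hg
    exact hf'.add hg'
  algebraMap_mem' c := by
    change ContDiff ℝ ∞ (fun _ : Fin n → ℝ => c)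
    exact contDiff_const

/-- The ring of smooth real functions on `V = ℝⁿ`. -/
def SmoothFun (n : ℕ) : Type := smoothSubalgebra n

instance (n : ℕ) : CommRing (SmoothFun n) := inferInstanceAs (CommRing (smoothSubalgebra n))

instance (n : ℕ) : Algebra ℝ (SmoothFun n) := inferInstanceAs (Algebra ℝ (smoothSubalgebra n))

/-- Evaluation of smooth functions at a point of `V`. -/
def evalAt {n : ℕ} (x : Fin n → ℝ) : SmoothFun n →+* ℝ :=
  (Pi.evalRingHom (fun _ : Fin n → ℝ => ℝ) x).comp (smoothSubalgebra n).val.toRingHom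

/-- The affine coordinate `xⁱ`. -/
def xFun {n : ℕ} (i : Fin n) : SmoothFun n :=
  ⟨fun x => x i, show ContDiff ℝ ∞ (fun x : Fin n → ℝ => x i) from contDiff_apply ℝ ℝ i⟩

/-- The partial derivative `∂/∂xⁱ` on smooth functions. -/
def partialX {n : ℕ} (i : Fin n) : Derivation ℝ (SmoothFun n) (SmoothFun n) :=
  Derivation.mk'
    { toFun := fun f => ⟨fun x => fderiv ℝ f.1 x (Pi.single i 1), by
        have h : ContDiff ℝ ∞ f.1 := f.2
        exact (h.fderiv_right (m := ∞) (by simp)).clm_apply contDiff_const⟩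
      map_add' := fun f g => by
        have hf : Differentiable ℝ f.1 := ContDiff.differentiable (n := ∞) f.2 (by simp)
        have hg : Differentiable ℝ g.1 := ContDiff.differentiable (n := ∞) g.2 (by simp)
        refine Subtype.ext (funext fun x => ?_)
        change fderiv ℝ (f.1 + g.1) x (Pi.single i 1) = _
        rw [fderiv_add (hf x) (hg x)]
        rfl
      map_smul' := fun c f => by
        have hf : Differentiable ℝ f.1 := ContDiff.differentiable (n := ∞) f.2 (by simp)
        refine Subtype.ext (funext fun x => ?_)
        change fderiv ℝ (c • f.1) x (Pi.single i 1) = _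
        rw [fderiv_const_smul (hf x)]
        rfl }
    (fun f g => by
        have hf : Differentiable ℝ f.1 := ContDiff.differentiable (n := ∞) f.2 (by simp)
        have hg : Differentiable ℝ g.1 := ContDiff.differentiable (n := ∞) g.2 (by simp)
        refine Subtype.ext (funext fun x => ?_)
        change fderiv ℝ (f.1 * g.1) x (Pi.single i 1) = _
        rw [fderiv_mul (hf x) (hg x)]
        rfl)

/-- Indices of the fibre coordinates `u_{x^{i₁}⋯x^{iₖ}}`, `k ≥ 1` (the order of the `iₐ` is
irrelevant). The coordinate `u` itself (`k = 0`, the information gain) is left out. -/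
abbrev FibreIdx (n : ℕ) : Type := {s : Multiset (Fin n) // s ≠ 0}

/-- The index of `D_{xⁱ} u_s`. -/
def FibreIdx.cons {n : ℕ} (i : Fin n) (s : FibreIdx n) : FibreIdx n :=
  ⟨i ::ₘ s.1, Multiset.cons_ne_zero⟩

/-- Polynomials in the fibre coordinates whose coefficients are smooth functions of `x`. -/
abbrev JetPoly (n : ℕ) : Type := MvPolynomial (FibreIdx n) (SmoothFun n)

/-- The admissible denominators: polynomials that do not vanish identically on any fibre. -/
def denoms (n : ℕ) : Submonoid (JetPoly n) where
  carrier := {Q | ∀ x : Fin n → ℝ, MvPolynomial.map (evalAt x) Q ≠ 0}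
  one_mem' := fun x => by simp
  mul_mem' := fun {P Q} hP hQ x => by
    rw [map_mul]
    exact mul_ne_zero (hP x) (hQ x)

/-- Differential functions: smooth in the base variables `x`, rational in the fibre variables
(of arbitrary finite order), and independent of `u`. -/
def DiffFun (n : ℕ) : Type := Localization (denoms n)

instance (n : ℕ) : CommRing (DiffFun n) := inferInstanceAs (CommRing (Localization (denoms n)))

instance (n : ℕ) : Algebra (JetPoly n) (DiffFun n) :=
  inferInstanceAs (Algebra (JetPoly n) (Localization (denoms n)))

instance (n : ℕ) : IsLocalization (denoms n) (DiffFun n) :=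
  inferInstanceAs (IsLocalization (denoms n) (Localization (denoms n)))

instance (n : ℕ) : Algebra ℝ (DiffFun n) :=
  ((algebraMap (JetPoly n) (DiffFun n)).comp (algebraMap ℝ (JetPoly n))).toAlgebra

instance (n : ℕ) : IsScalarTower ℝ (JetPoly n) (DiffFun n) :=
  IsScalarTower.of_algebraMap_eq fun _ => rfl

/-- The quotient `P / Q`. -/
def quot {n : ℕ} (P : JetPoly n) (Q : denoms n) : DiffFun n := IsLocalization.mk' (DiffFun n) P Q

/-- A smooth function on `V` as a differential function. -/
def ofSmooth {n : ℕ} : SmoothFun n →+* DiffFun n :=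
  (algebraMap (JetPoly n) (DiffFun n)).comp MvPolynomial.C

/-- The fibre coordinate `u_s` as a differential function. -/
def uCoord {n : ℕ} (s : FibreIdx n) : DiffFun n :=
  algebraMap (JetPoly n) (DiffFun n) (MvPolynomial.X s)

/-! ### Total derivatives

`Dᵢ` is the derivation with `Dᵢ a = ∂a/∂xⁱ` for `a = a(x)` and `Dᵢ u_s = u_{s,i}`. It is
constructed as the `ε`-part of the ring homomorphism `f ↦ f + ε Dᵢ f` into the dual numbers. -/

/-- `a ↦ a + ε ∂ᵢa` on smooth functions. -/
def dualSmooth {n : ℕ} (i : Fin n) : SmoothFun n →+* DualNumber (DiffFun n) where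
  toFun a := TrivSqZeroExt.inl (ofSmooth a) + TrivSqZeroExt.inr (ofSmooth (partialX i a))
  map_one' := by
    ext <;> simp
  map_zero' := by
    ext <;> simp
  map_add' a b := by
    ext <;> simp
  map_mul' a b := by
    ext
    · simp
    · simp [Derivation.leibniz, smul_eq_mul, mul_comm]

/-- `P ↦ P + ε Dᵢ P` on polynomials. -/
def dualPoly {n : ℕ} (i : Fin n) : JetPoly n →+* DualNumber (DiffFun n) :=
  MvPolynomial.eval₂Hom (dualSmooth i)
    (fun s => TrivSqZeroExt.inl (uCoord s) + TrivSqZeroExt.inr (uCoord (s.cons i)))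

theorem fst_dualPoly {n : ℕ} (i : Fin n) (P : JetPoly n) :
    (dualPoly i P).fst = algebraMap (JetPoly n) (DiffFun n) P := by
  induction P using MvPolynomial.induction_on with
  | C a => simp [dualPoly, dualSmooth, ofSmooth]
  | add P Q hP hQ => simp only [map_add, TrivSqZeroExt.fst_add, hP, hQ]
  | mul_X P s hP =>
    rw [map_mul, TrivSqZeroExt.fst_mul, hP, map_mul]
    congr 1
    simp [dualPoly, uCoord]

theorem isUnit_dualPoly {n : ℕ} (i : Fin n) (Q : denoms n) : IsUnit (dualPoly i (Q : JetPoly n)) := by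
  rw [TrivSqZeroExt.isUnit_iff_isUnit_fst, fst_dualPoly]
  exact IsLocalization.map_units (DiffFun n) Q

/-- `f ↦ f + ε Dᵢ f` on differential functions. -/
def dualDiff {n : ℕ} (i : Fin n) : DiffFun n →+* DualNumber (DiffFun n) :=
  IsLocalization.lift (M := denoms n) (g := dualPoly i) (isUnit_dualPoly i)

theorem fst_dualDiff {n : ℕ} (i : Fin n) (f : DiffFun n) : (dualDiff i f).fst = f := by
  have h : ((TrivSqZeroExt.fstHom (DiffFun n) (DiffFun n) (DiffFun n)).toRingHom.comp
      (dualDiff i)) = RingHom.id (DiffFun n) := by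
    refine IsLocalization.ringHom_ext (denoms n) (RingHom.ext fun P => ?_)
    change (dualDiff i (algebraMap (JetPoly n) (DiffFun n) P)).fst = _
    rw [dualDiff, IsLocalization.lift_eq, fst_dualPoly]
    rfl
  exact congrArg (fun φ : DiffFun n →+* DiffFun n => φ f) h

theorem dualDiff_algebraMap {n : ℕ} (i : Fin n) (c : ℝ) :
    (dualDiff i (algebraMap ℝ (DiffFun n) c)).snd = 0 := by
  rw [IsScalarTower.algebraMap_apply ℝ (JetPoly n) (DiffFun n), dualDiff,
    IsLocalization.lift_eq, IsScalarTower.algebraMap_apply ℝ (SmoothFun n) (JetPoly n),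
    MvPolynomial.algebraMap_eq]
  simp [dualPoly, dualSmooth, ofSmooth]

/-- The total derivative `Dᵢ`. -/
def totalD {n : ℕ} (i : Fin n) : Derivation ℝ (DiffFun n) (DiffFun n) :=
  Derivation.mk'
    { toFun := fun f => (dualDiff i f).snd
      map_add' := fun f g => by simp
      map_smul' := fun c f => by
        rw [Algebra.smul_def, map_mul, TrivSqZeroExt.snd_mul, dualDiff_algebraMap, fst_dualDiff]
        simp [Algebra.smul_def] }
    (fun f g => by
      change (dualDiff i (f * g)).snd = _
      rw [map_mul, TrivSqZeroExt.snd_mul, fst_dualDiff, fst_dualDiff]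
      simp [smul_eq_mul, mul_comm])

theorem totalD_ofSmooth {n : ℕ} (i : Fin n) (a : SmoothFun n) :
    totalD i (ofSmooth a) = ofSmooth (partialX i a) := by
  change (dualDiff i (ofSmooth a)).snd = _
  rw [dualDiff, show ofSmooth a = algebraMap (JetPoly n) (DiffFun n) (MvPolynomial.C a) from rfl,
    IsLocalization.lift_eq]
  simp [dualPoly, dualSmooth]

theorem totalD_uCoord {n : ℕ} (i : Fin n) (s : FibreIdx n) :
    totalD i (uCoord s) = uCoord (s.cons i) := by
  change (dualDiff i (uCoord s)).snd = _
  rw [dualDiff, uCoord, IsLocalization.lift_eq]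
  simp [dualPoly]

/-! ### The dual variables, moments and central moments -/

/-- `λᵢ = u_{xⁱ}`. -/
def lam {n : ℕ} (i : Fin n) : DiffFun n := uCoord ⟨{i}, Multiset.singleton_ne_zero i⟩

/-- The Jacobian matrix `∂λᵢ/∂xʲ = u_{xⁱxʲ}`. -/
def hess (n : ℕ) : Matrix (Fin n) (Fin n) (DiffFun n) :=
  Matrix.of fun i j => totalD j (lam i)

/-- The derivative `∂/∂λᵢ` along the Lagrangian submanifold `λ = u_x`, that is
`∂/∂λᵢ = ∑ⱼ (∂xʲ/∂λᵢ) Dⱼ` with `∂x/∂λ = (∂λ/∂x)⁻¹`. -/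
def dLam {n : ℕ} (i : Fin n) (f : DiffFun n) : DiffFun n :=
  ∑ j, (hess n)⁻¹ j i * totalD j f

/-- The component `Z_{λ_{i₁}⋯λ_{iₖ}} / Z` of the `k`-th moment, where `Z = exp (-H)` and
`∂H/∂λᵢ = -xⁱ`, so that `Z_{λᵢ} = xⁱ Z`: if `Z_τ = m_τ Z` then
`Z_{iτ} = (∂m_τ/∂λᵢ + xⁱ m_τ) Z`. -/
def moment {n : ℕ} : List (Fin n) → DiffFun n
  | [] => 1
  | i :: τ => ofSmooth (xFun i) * moment τ + dLam i (moment τ)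

/-- The component with indices `τ` of the `k`-th central moment
`∑ᵢ (-1)^(k-i) (k choose i) mᵢ ⊙ m₁^{⊗(k-i)}`; the binomial coefficient and the symmetrization
together give the sum over the subsets of the `k` slots. -/
def centralMoment {n k : ℕ} (τ : Fin k → Fin n) : DiffFun n :=
  ∑ S : Finset (Fin k), (-1) ^ (k - S.card) *
    moment (((List.finRange k).filter (fun a => a ∈ S)).map τ) *
      ∏ a ∈ Sᶜ, moment [τ a]

/-- The horizontal vector field `∑ⱼ wʲ Dⱼ`, given by its components, acting as a derivation. -/
def vecAct {n : ℕ} (w : Fin n → DiffFun n) (f : DiffFun n) : DiffFun n :=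
  ∑ j, w j * totalD j f

/-- The symmetric `k`-form `σₖ = ∑ σ^{i₁⋯iₖ} dλ_{i₁} ⊗ ⋯ ⊗ dλ_{iₖ}` evaluated on horizontal
vector fields, with `dλᵢ(w) = w(λᵢ)`. -/
def sigma {n : ℕ} (k : ℕ) (w : Fin k → Fin n → DiffFun n) : DiffFun n :=
  ∑ τ : Fin k → Fin n, centralMoment τ * ∏ a, vecAct (w a) (lam (τ a))

/-! ### The invariant frame -/

/-- The coordinate field `Dⱼ`. -/
def coordVec {n : ℕ} (j : Fin n) : Fin n → DiffFun n := Pi.single j 1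

/-- The matrix of `σ₂` in the coordinate frame. -/
def sigmaTwoMatrix (n : ℕ) : Matrix (Fin n) (Fin n) (DiffFun n) :=
  Matrix.of fun i j => sigma 2 ![coordVec i, coordVec j]

/-- `v₁ = σ₂⁻¹(α₁)`, where `α₁ = λᵢ dxⁱ`. -/
def vOne (n : ℕ) : Fin n → DiffFun n :=
  (sigmaTwoMatrix n)⁻¹.mulVec lam

/-- The endomorphism `A` with `σ₂(A w, w') = σ₃(v₁, w, w')`. -/
def endoA (n : ℕ) : Matrix (Fin n) (Fin n) (DiffFun n) :=
  (sigmaTwoMatrix n)⁻¹ * Matrix.of fun i j => sigma 3 ![vOne n, coordVec i, coordVec j]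

/-- The frame `v_{i+1} = Aⁱ v₁`, `i = 0, …, n-1`. -/
def frame {n : ℕ} (i : Fin n) : Fin n → DiffFun n :=
  (endoA n ^ (i : ℕ)).mulVec (vOne n)

/-- The frame vectors as derivations of the algebra of differential functions. -/
def frameD {n : ℕ} (i : Fin n) (f : DiffFun n) : DiffFun n := vecAct (frame i) f

/-- The component of `σₖ` in the frame. -/
def sigmaFrame {n k : ℕ} (τ : Fin k → Fin n) : DiffFun n := sigma k fun a => frame (τ a)

/-! ### The affine group and differential invariants -/

/-- Points of the space of infinite jets of functions on `V`: the base point and the values of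
all the coordinates `u_s` (with `u_0 = u`). -/
structure JetPoint (n : ℕ) where
  x : Fin n → ℝ
  u : Multiset (Fin n) → ℝ

/-- The group `Aff(V)`. -/
abbrev Aff (n : ℕ) : Type := (Fin n → ℝ) ≃ᵃ[ℝ] (Fin n → ℝ)

/-- The linear form `∑ⱼ (A⁻¹)ʲᵢ ξⱼ`, where `A` is the linear part of `g`: the expression of
`∂/∂x'ⁱ` in the derivatives `ξⱼ = ∂/∂xʲ` for `x' = g x`. -/
def dualForm {n : ℕ} (g : Aff n) (i : Fin n) : MvPolynomial (Fin n) ℝ :=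
  ∑ j, MvPolynomial.C (g.linear.symm (Pi.single i 1) j) * MvPolynomial.X j

/-- The prolonged action of `Aff(V)`, which takes the jet of `I` at `x` to the jet of `I ∘ g⁻¹` at
`g x`. By the chain rule `u'_s` is obtained from the product of the forms `∂/∂x'ⁱ`, `i ∈ s`, by
replacing each monomial in the `∂/∂xʲ` by the corresponding derivative of `u`. In particular
`u' = u` and `λ' = (A⁻¹)ᵀ λ`. -/
def JetPoint.act {n : ℕ} (g : Aff n) (θ : JetPoint n) : JetPoint n where
  x := g θ.x
  u := fun s => ∑ β ∈ (s.map (dualForm g)).prod.support,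
    (s.map (dualForm g)).prod.coeff β * θ.u (Finsupp.toMultiset β)

/-- The value of a polynomial at a jet. -/
def evalJet {n : ℕ} (θ : JetPoint n) (P : JetPoly n) : ℝ :=
  MvPolynomial.eval₂ (evalAt θ.x) (fun s => θ.u s.1) P

/-- The differential function `f` is defined at the jet `θ`, with value `c`. -/
def HasValue {n : ℕ} (f : DiffFun n) (θ : JetPoint n) (c : ℝ) : Prop :=
  ∃ (P : JetPoly n) (Q : denoms n), f = quot P Q ∧ evalJet θ (Q : JetPoly n) ≠ 0 ∧
    c = evalJet θ P / evalJet θ (Q : JetPoly n)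

/-- `f' = g^* f`, that is `f' = f ∘ g` wherever both sides are defined. -/
def IsPullback {n : ℕ} (g : Aff n) (f f' : DiffFun n) : Prop :=
  ∀ (θ : JetPoint n) (c c' : ℝ), HasValue f (θ.act g) c → HasValue f' θ c' → c = c'

/-- (Scalar) differential invariants: differential functions constant on `Aff(V)`-orbits. -/
def IsDiffInvariant {n : ℕ} (f : DiffFun n) : Prop := ∀ g : Aff n, IsPullback g f f

/-- `f` is rational in the derivatives of `u` of order at most `l` and polynomial in those of
higher order. -/
def IsPolynomialAbove {n : ℕ} (l : ℕ) (f : DiffFun n) : Prop :=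
  ∃ (P : JetPoly n) (Q : denoms n), f = quot P Q ∧
    ∀ s ∈ (Q : JetPoly n).vars, s.1.card ≤ l

/-! ### Generation -/

/-- A subalgebra closed under the inverses that exist among the differential functions. -/
def InvClosed {n : ℕ} (B : Subalgebra ℝ (DiffFun n)) : Prop :=
  ∀ f ∈ B, ∀ h : DiffFun n, f * h = 1 → h ∈ B

/-- A subalgebra closed under the derivations `v₁, …, vₙ`. -/
def FrameClosed {n : ℕ} (B : Subalgebra ℝ (DiffFun n)) : Prop :=
  ∀ f ∈ B, ∀ i : Fin n, frameD i f ∈ B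

/-- Rational functions of the elements of `G`. -/
def ratGen {n : ℕ} (G : Set (DiffFun n)) : Subalgebra ℝ (DiffFun n) :=
  sInf {B | G ⊆ B ∧ InvClosed B}

/-- Polynomials in the elements of `G` and their iterated derivatives along `v₁, …, vₙ`. -/
def diffAlgGen {n : ℕ} (G : Set (DiffFun n)) : Subalgebra ℝ (DiffFun n) :=
  sInf {B | G ⊆ B ∧ FrameClosed B}

/-- Rational functions of the elements of `G` and their iterated derivatives along
`v₁, …, vₙ`. -/
def diffFieldGen {n : ℕ} (G : Set (DiffFun n)) : Subalgebra ℝ (DiffFun n) :=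
  sInf {B | G ⊆ B ∧ InvClosed B ∧ FrameClosed B}

/-- The generators of order at most three: `σ₂(v₁,v₁)` and the `σ₃(vᵢ,vⱼ,vₖ)`. -/
def gensThree (n : ℕ) [NeZero n] : Set (DiffFun n) :=
  {sigmaFrame ![(0 : Fin n), 0]} ∪ Set.range (sigmaFrame (n := n) (k := 3))

/-- The generators of order four: the `σ₄(vᵢ,vⱼ,vₖ,vₗ)`. -/
def gensFour (n : ℕ) : Set (DiffFun n) := Set.range (sigmaFrame (n := n) (k := 4))

end AffInv

end

/-! Write u_k for the symmetric form of k-th derivatives of u, evaluated on horizontal fields. As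
dλ_i(w) = (h w)_i and ∂x/∂λ = h⁻¹, differentiating repeatedly gives σ_2 = u_2, σ_3 = -u_3, and σ_4 =
-u_4 plus terms built from u_2, u_3 and h⁻¹ (`sigma_two`, `sigma_three`, `sigma_four`). Hence v_1
and A are determined by u_2(v_1, ·) = u_1 and u_2(A w, ·) = -u_3(v_1, w, ·). These equations involve
no coordinates, so the frame is equivariant (`mul_frameOf_substJet`) and the v_i commute with
pull-backs (`pull_frameD`). One explicit jet with a Vandermonde frame shows that the frame is
generically a basis.

Every invariant is a quotient of polynomials in the frame components u_k(v_{i_1}, …, v_{i_k}):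
translations remove x, and linear invariance permits evaluation in the basis v. The denominator
could vanish identically on jets normalised in this way; a fixed linear change of coordinates
prevents that and does not raise its order (`IsDiffInvariant.exists_frameEval`).

It remains to generate the frame components. In order at most three, u_1(v_i) = u_2(v_1, v_i) and
u_2(v_{i+1}, v_j) = -u_3(v_1, v_i, v_j) leave only the given generators, and σ_4 yields u_4. Let ∇
differentiate components of vector fields. Then u_{k+1}(v_i, q) = v_i(u_k(q)) - u_k(∇_{v_i} q),
which reaches all higher orders once the ∇_{v_i} v_j have known frame components
(`jetFun_mem_of_framePoly_of_frameClosed`). Those come from differentiating the equations that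
define the frame; they involve u_2, u_3, u_4 and the inverse of the Gram matrix u_2(v_i, v_j)
(`vecDer_fvec_mem_framePoly`).

The only inverses needed to generate the frame components are of order at most three. The argument
therefore runs with two algebras `B ≤ B'`: `B` contains the third-order generators and is closed
under inverses, `B'` contains the fourth-order ones and is closed under the v_i. Statement 1 takes
`B = B'`, statement 2 takes for `B` the rational functions of the third-order generators. -/

open MvPolynomial
open scoped Matrix

noncomputable section

namespace AffInv

variable {n : ℕ}

section jets

variable {R S : Type*} [CommRing R] [CommRing S]

/-! ### Jets with values in a commutative ring

A family `U : FibreIdx n → R` is regarded as the jet of a function with values in `R`. The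
symmetric forms `Uₖ(w₁, …, wₖ)` are the values of a single linear functional on polynomials at
products of linear forms. -/

/-- The `R`-linear functional with `X_{i₁}⋯X_{iₖ} ↦ U_{i₁⋯iₖ}` for `k ≥ 1` and `1 ↦ 0`. -/
def jetFun (U : FibreIdx n → R) : MvPolynomial (Fin n) R →ₗ[R] R :=
  (basisMonomials (Fin n) R).constr R fun β =>
    if h : Finsupp.toMultiset β ≠ 0 then U ⟨Finsupp.toMultiset β, h⟩ else 0

theorem jetFun_monomial (U : FibreIdx n → R) (β : Fin n →₀ ℕ) (c : R) :
    jetFun U (monomial β c) =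
      c * if h : Finsupp.toMultiset β ≠ 0 then U ⟨Finsupp.toMultiset β, h⟩ else 0 := by
  have h1 : monomial β c = c • (monomial β (1 : R)) := by simp [smul_monomial]
  rw [h1, map_smul, smul_eq_mul, jetFun]
  congr 1
  have := (basisMonomials (Fin n) R).constr_basis R (fun β =>
    if h : Finsupp.toMultiset β ≠ 0 then U ⟨Finsupp.toMultiset β, h⟩ else 0) β
  rwa [coe_basisMonomials] at this

@[simp] theorem jetFun_C (U : FibreIdx n → R) (c : R) : jetFun U (C c) = 0 := by
  rw [C_apply, jetFun_monomial]; simp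

theorem jetFun_one (U : FibreIdx n → R) : jetFun U 1 = 0 := jetFun_C U 1

theorem jetFun_C_mul (U : FibreIdx n → R) (c : R) (p : MvPolynomial (Fin n) R) :
    jetFun U (C c * p) = c * jetFun U p := by
  rw [← smul_eq_C_mul, map_smul, smul_eq_mul]

theorem prod_map_X (s : Multiset (Fin n)) :
    (s.map (X : Fin n → MvPolynomial (Fin n) R)).prod = monomial (Multiset.toFinsupp s) 1 := by
  induction s using Multiset.induction_on with
  | empty => simp
  | cons a s ih =>
    rw [Multiset.map_cons, Multiset.prod_cons, ih, ← Multiset.singleton_add, map_add, X,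
      monomial_mul, Multiset.toFinsupp_singleton, one_mul]

theorem jetFun_prod_X (U : FibreIdx n → R) (s : FibreIdx n) :
    jetFun U ((s.1.map X).prod) = U s := by
  rw [prod_map_X, jetFun_monomial, one_mul]
  have h : Finsupp.toMultiset (Multiset.toFinsupp s.1) = s.1 := Multiset.toFinsupp_toMultiset s.1
  rw [dif_pos (by rw [h]; exact s.2)]
  congr 1
  exact Subtype.ext h

/-- Naturality in the coefficient ring is what carries identities to values at a jet and to
pull-backs. -/
theorem map_jetFun (f : R →+* S) (U : FibreIdx n → R) (p : MvPolynomial (Fin n) R) :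
    f (jetFun U p) = jetFun (f ∘ U) (map f p) := by
  induction p using MvPolynomial.induction_on' with
  | monomial β a =>
    rw [map_monomial, jetFun_monomial, jetFun_monomial, map_mul]
    congr 1
    split_ifs <;> simp
  | add p q hp hq => simp only [map_add, hp, hq]

/-- The linear form `∑ⱼ wⱼ Xⱼ`. -/
def linForm : (Fin n → R) →ₗ[R] MvPolynomial (Fin n) R where
  toFun w := ∑ j, C (w j) * X j
  map_add' w w' := by simp [add_mul, Finset.sum_add_distrib]
  map_smul' c w := by simp [smul_eq_C_mul, Finset.mul_sum, mul_assoc]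

theorem linForm_apply (w : Fin n → R) : linForm w = ∑ j, C (w j) * X j := rfl

@[simp] theorem linForm_single (i : Fin n) : linForm (Pi.single i (1 : R)) = X i := by
  classical
  rw [linForm_apply, Finset.sum_eq_single i] <;> simp +contextual

theorem map_linForm (f : R →+* S) (w : Fin n → R) : map f (linForm w) = linForm (f ∘ w) := by
  simp [linForm_apply]

theorem constantCoeff_linForm (w : Fin n → R) : constantCoeff (linForm w) = 0 := by
  simp [linForm_apply]

theorem jetFun_mul_linForm (U : FibreIdx n → R) (p : MvPolynomial (Fin n) R) (y : Fin n → R) :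
    jetFun U (p * linForm y) = ∑ i, y i * jetFun U (p * X i) := by
  rw [linForm_apply, Finset.mul_sum, map_sum]
  refine Finset.sum_congr rfl fun i _ => ?_
  rw [mul_left_comm, jetFun_C_mul]

/-- The product of the linear forms given by the columns `s` of the matrix `B`. -/
def colProd (B : Matrix (Fin n) (Fin n) R) (s : Multiset (Fin n)) : MvPolynomial (Fin n) R :=
  (s.map fun i => linForm (B.col i)).prod

theorem map_colProd (f : R →+* S) (B : Matrix (Fin n) (Fin n) R) (s : Multiset (Fin n)) :
    map f (colProd B s) = colProd (B.map f) s := by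
  rw [colProd, colProd, map_multiset_prod, Multiset.map_map]
  simp only [Function.comp_def, map_linForm]
  rfl

theorem constantCoeff_colProd (B : Matrix (Fin n) (Fin n) R) (s : FibreIdx n) :
    constantCoeff (colProd B s.1) = 0 := by
  obtain ⟨i, hi⟩ := Multiset.exists_mem_of_ne_zero s.2
  obtain ⟨t, ht⟩ := Multiset.exists_cons_of_mem hi
  rw [colProd, ht, Multiset.map_cons, Multiset.prod_cons, map_mul, constantCoeff_linForm, zero_mul]

/-- The jet in the frame given by the columns of `B`. -/
def substJet (U : FibreIdx n → R) (B : Matrix (Fin n) (Fin n) R) : FibreIdx n → R :=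
  fun s => jetFun U (colProd B s.1)

theorem map_substJet (f : R →+* S) (U : FibreIdx n → R) (B : Matrix (Fin n) (Fin n) R) :
    f ∘ substJet U B = substJet (f ∘ U) (B.map f) := by
  funext s
  simp only [Function.comp_apply, substJet, map_jetFun, map_colProd]

/-- A change of frame is precomposition of the functional with a substitution of linear forms, so
the composition law and the equivariance of the frame become formal. -/
theorem jetFun_substJet (U : FibreIdx n → R) (B : Matrix (Fin n) (Fin n) R)
    (p : MvPolynomial (Fin n) R) :
    jetFun (substJet U B) p = jetFun U (aeval (fun i => linForm (B.col i)) p) := by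
  induction p using MvPolynomial.induction_on' with
  | monomial β a =>
    have hm : monomial β a = C a * ((Finsupp.toMultiset β).map X).prod := by
      rw [prod_map_X, Finsupp.toMultiset_toFinsupp, C_mul_monomial, mul_one]
    rw [hm, jetFun_C_mul, map_mul (aeval _), aeval_C, algebraMap_eq, jetFun_C_mul,
      map_multiset_prod (aeval _), Multiset.map_map]
    congr 1
    by_cases h : Finsupp.toMultiset β = 0
    · simp [h, jetFun_one]
    · rw [jetFun_prod_X (substJet U B) ⟨_, h⟩]
      simp only [Function.comp_def, aeval_X]
      rfl
  | add p q hp hq => simp only [map_add, hp, hq]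

theorem aeval_linForm (B : Matrix (Fin n) (Fin n) R) (w : Fin n → R) :
    aeval (fun i => linForm (B.col i)) (linForm w) = linForm (B *ᵥ w) := by
  rw [linForm_apply, map_sum]
  simp only [map_mul, aeval_C, aeval_X, algebraMap_eq, linForm_apply, Matrix.col_apply,
    Matrix.mulVec, dotProduct, Finset.mul_sum, map_sum, Finset.sum_mul]
  rw [Finset.sum_comm]
  refine Finset.sum_congr rfl fun j _ => Finset.sum_congr rfl fun i _ => ?_
  ring

theorem aeval_colProd (B B' : Matrix (Fin n) (Fin n) R) (s : Multiset (Fin n)) :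
    aeval (fun i => linForm (B.col i)) (colProd B' s) = colProd (B * B') s := by
  rw [colProd, map_multiset_prod, Multiset.map_map, colProd]
  simp only [Function.comp_def, aeval_linForm]
  rfl

theorem substJet_substJet (U : FibreIdx n → R) (B B' : Matrix (Fin n) (Fin n) R) :
    substJet (substJet U B) B' = substJet U (B * B') := by
  funext s
  rw [substJet, jetFun_substJet, aeval_colProd]
  rfl

theorem substJet_one (U : FibreIdx n → R) : substJet U 1 = U := by
  funext s
  have : colProd (1 : Matrix (Fin n) (Fin n) R) s.1 = (s.1.map X).prod := by
    rw [colProd]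
    congr 2
    funext i
    rw [← linForm_single i]
    congr 1
    funext j
    simp [Matrix.one_apply, Pi.single_apply]
  rw [substJet, this, jetFun_prod_X]

/-! ### The frame of a jet -/

/-- The matrix of second derivatives. -/
def hessOf (U : FibreIdx n → R) : Matrix (Fin n) (Fin n) R :=
  Matrix.of fun i j => jetFun U (X i * X j)

/-- The first derivatives. -/
def lamOf (U : FibreIdx n → R) : Fin n → R := fun i => jetFun U (X i)

/-- The vector `h⁻¹ λ`. -/
def vOneOf (U : FibreIdx n → R) : Fin n → R := (hessOf U)⁻¹ *ᵥ lamOf U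

/-- The endomorphism `-h⁻¹ U₃(v₁, ·, ·)`. -/
def endoOf (U : FibreIdx n → R) : Matrix (Fin n) (Fin n) R :=
  (hessOf U)⁻¹ * Matrix.of fun i j => -jetFun U (linForm (vOneOf U) * X i * X j)

/-- The matrix with columns `Aⁱ v₁`. -/
def frameOf (U : FibreIdx n → R) : Matrix (Fin n) (Fin n) R :=
  Matrix.of fun j i => ((endoOf U ^ (i : ℕ)) *ᵥ vOneOf U) j

theorem frameOf_col (U : FibreIdx n → R) (i : Fin n) :
    (frameOf U).col i = (endoOf U ^ (i : ℕ)) *ᵥ vOneOf U := rfl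

theorem jetFun_linForm_mul_X (U : FibreIdx n → R) (w : Fin n → R) (i : Fin n) :
    jetFun U (linForm w * X i) = (hessOf U *ᵥ w) i := by
  rw [mul_comm, jetFun_mul_linForm]
  simp [Matrix.mulVec, dotProduct, hessOf, mul_comm]

/-- Nondegeneracy of h. Vectors defined through h⁻¹ are recognised below by their products with a
basis, which avoids computing with the inverse matrix. -/
theorem hessOf_mulVec_inj {U : FibreIdx n → R} (hU : IsUnit (hessOf U).det) {w w' : Fin n → R}
    (h : ∀ i, jetFun U (linForm w * X i) = jetFun U (linForm w' * X i)) : w = w' := by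
  have h' : hessOf U *ᵥ w = hessOf U *ᵥ w' := by
    funext i
    rw [← jetFun_linForm_mul_X, ← jetFun_linForm_mul_X, h]
  have := congrArg (fun v => (hessOf U)⁻¹ *ᵥ v) h'
  simpa [Matrix.mulVec_mulVec, Matrix.nonsing_inv_mul _ hU] using this

theorem jetFun_vOneOf_mul_X {U : FibreIdx n → R} (hU : IsUnit (hessOf U).det) (i : Fin n) :
    jetFun U (linForm (vOneOf U) * X i) = jetFun U (X i) := by
  rw [jetFun_linForm_mul_X, vOneOf, Matrix.mulVec_mulVec, Matrix.mul_nonsing_inv _ hU,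
    Matrix.one_mulVec, lamOf]

theorem jetFun_vOneOf_mul {U : FibreIdx n → R} (hU : IsUnit (hessOf U).det) (y : Fin n → R) :
    jetFun U (linForm (vOneOf U) * linForm y) = jetFun U (linForm y) := by
  rw [jetFun_mul_linForm, ← one_mul (linForm y), jetFun_mul_linForm]
  simp [jetFun_vOneOf_mul_X hU]

theorem jetFun_endoOf_mul_X {U : FibreIdx n → R} (hU : IsUnit (hessOf U).det) (w : Fin n → R)
    (i : Fin n) : jetFun U (linForm (endoOf U *ᵥ w) * X i) =
      -jetFun U (linForm (vOneOf U) * linForm w * X i) := by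
  rw [jetFun_linForm_mul_X, endoOf, Matrix.mulVec_mulVec, ← Matrix.mul_assoc,
    Matrix.mul_nonsing_inv _ hU, Matrix.one_mul, mul_right_comm, jetFun_mul_linForm]
  simp [Matrix.mulVec, dotProduct, mul_comm]

theorem jetFun_endoOf_mul {U : FibreIdx n → R} (hU : IsUnit (hessOf U).det) (w y : Fin n → R) :
    jetFun U (linForm (endoOf U *ᵥ w) * linForm y) =
      -jetFun U (linForm (vOneOf U) * linForm w * linForm y) := by
  rw [jetFun_mul_linForm, jetFun_mul_linForm]
  simp [jetFun_endoOf_mul_X hU]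

theorem hessOf_substJet (U : FibreIdx n → R) (B : Matrix (Fin n) (Fin n) R) :
    hessOf (substJet U B) = Bᵀ * hessOf U * B := by
  ext i j
  change jetFun (substJet U B) (X i * X j) = _
  rw [jetFun_substJet, map_mul, aeval_X, aeval_X, mul_comm, jetFun_mul_linForm]
  simp only [jetFun_linForm_mul_X, Matrix.mul_apply, Matrix.mulVec, dotProduct, Matrix.col_apply,
    Matrix.transpose_apply, Finset.sum_mul, Finset.mul_sum]
  rw [Finset.sum_comm]
  refine Finset.sum_congr rfl fun a _ => Finset.sum_congr rfl fun b _ => ?_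
  ring

theorem isUnit_det_hessOf_substJet {U : FibreIdx n → R} (hU : IsUnit (hessOf U).det)
    {B : Matrix (Fin n) (Fin n) R} (hB : IsUnit B.det) : IsUnit (hessOf (substJet U B)).det := by
  rw [hessOf_substJet, Matrix.det_mul, Matrix.det_mul, Matrix.det_transpose]
  exact (hB.mul hU).mul hB

/-- Equality of vectors is tested against the columns of an invertible matrix. -/
theorem hessOf_ext_col {U : FibreIdx n → R} (hU : IsUnit (hessOf U).det)
    {B : Matrix (Fin n) (Fin n) R} (hB : IsUnit B.det) {w w' : Fin n → R}
    (h : ∀ i, jetFun U (linForm w * linForm (B.col i)) =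
      jetFun U (linForm w' * linForm (B.col i))) : w = w' := by
  refine hessOf_mulVec_inj hU fun i => ?_
  -- The basis vector e_i equals B(B⁻¹ e_i), a combination of the columns of `B`.
  have hX : (X i : MvPolynomial (Fin n) R) = ∑ k, C (B⁻¹ k i) * linForm (B.col k) := by
    rw [← linForm_single i, ← Matrix.one_mulVec (Pi.single i (1 : R)),
      ← Matrix.mul_nonsing_inv _ hB, ← Matrix.mulVec_mulVec]
    rw [← aeval_linForm, linForm_apply, map_sum]
    refine Finset.sum_congr rfl fun k _ => ?_
    simp [algebraMap_eq]
  rw [hX, Finset.mul_sum, Finset.mul_sum, map_sum, map_sum]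
  refine Finset.sum_congr rfl fun k _ => ?_
  rw [mul_left_comm, jetFun_C_mul, h, mul_left_comm, jetFun_C_mul]

/-- Both sides solve u_2(v, ·) = u_1. The equation for the substituted jet is the original one
tested on the columns of `B`. -/
theorem mulVec_vOneOf_substJet {U : FibreIdx n → R} (hU : IsUnit (hessOf U).det)
    {B : Matrix (Fin n) (Fin n) R} (hB : IsUnit B.det) :
    B *ᵥ vOneOf (substJet U B) = vOneOf U := by
  refine hessOf_ext_col hU hB fun i => ?_
  have h := jetFun_vOneOf_mul_X (isUnit_det_hessOf_substJet hU hB) i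
  rw [jetFun_substJet, map_mul, aeval_linForm, aeval_X, jetFun_substJet, aeval_X] at h
  rw [h, jetFun_vOneOf_mul hU]

theorem mulVec_endoOf_substJet {U : FibreIdx n → R} (hU : IsUnit (hessOf U).det)
    {B : Matrix (Fin n) (Fin n) R} (hB : IsUnit B.det) (w : Fin n → R) :
    B *ᵥ (endoOf (substJet U B) *ᵥ w) = endoOf U *ᵥ (B *ᵥ w) := by
  refine hessOf_ext_col hU hB fun i => ?_
  have h := jetFun_endoOf_mul_X (isUnit_det_hessOf_substJet hU hB) w i
  simp only [jetFun_substJet, map_mul, aeval_linForm, aeval_X, mulVec_vOneOf_substJet hU hB] at h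
  rw [h, jetFun_endoOf_mul hU]

theorem mul_frameOf_substJet {U : FibreIdx n → R} (hU : IsUnit (hessOf U).det)
    {B : Matrix (Fin n) (Fin n) R} (hB : IsUnit B.det) :
    B * frameOf (substJet U B) = frameOf U := by
  have key : ∀ k : ℕ, B *ᵥ ((endoOf (substJet U B) ^ k) *ᵥ vOneOf (substJet U B)) =
      (endoOf U ^ k) *ᵥ vOneOf U := by
    intro k
    induction k with
    | zero => simpa using mulVec_vOneOf_substJet hU hB
    | succ k ih =>
      rw [pow_succ', ← Matrix.mulVec_mulVec, mulVec_endoOf_substJet hU hB, ih,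
        Matrix.mulVec_mulVec, ← pow_succ']
  ext j i
  exact congrFun (key i) j

theorem hessOf_map (f : R →+* S) (U : FibreIdx n → R) :
    (hessOf U).map f = hessOf (f ∘ U) := by
  ext i j
  simp [hessOf, map_jetFun]

theorem det_hessOf_map (f : R →+* S) (U : FibreIdx n → R) :
    f (hessOf U).det = (hessOf (f ∘ U)).det := by
  rw [RingHom.map_det, RingHom.mapMatrix_apply, hessOf_map]

/-- A matrix inverse is zero when the determinant is not a unit, so naturality needs `hU`. Given it,
the images satisfy the defining equations of the frame over `S`, whose solutions are unique. -/
theorem frameOf_map (f : R →+* S) {U : FibreIdx n → R} (hU : IsUnit (hessOf U).det) :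
    (frameOf U).map f = frameOf (f ∘ U) := by
  have hU' : IsUnit (hessOf (f ∘ U)).det := by
    rw [← det_hessOf_map]; exact hU.map f
  have h1 : f ∘ vOneOf U = vOneOf (f ∘ U) := by
    refine hessOf_mulVec_inj hU' fun i => ?_
    have := congrArg f (jetFun_vOneOf_mul_X hU i)
    simp only [map_jetFun, map_mul, map_linForm, map_X] at this
    rw [this, jetFun_vOneOf_mul_X hU']
  have h2 : ∀ w, f ∘ (endoOf U *ᵥ w) = endoOf (f ∘ U) *ᵥ (f ∘ w) := by
    intro w
    refine hessOf_mulVec_inj hU' fun i => ?_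
    have := congrArg f (jetFun_endoOf_mul_X hU w i)
    simp only [map_neg, map_jetFun, map_mul, map_linForm, map_X, h1] at this
    rw [this, jetFun_endoOf_mul_X hU']
  have h3 : ∀ k : ℕ, f ∘ ((endoOf U ^ k) *ᵥ vOneOf U) =
      (endoOf (f ∘ U) ^ k) *ᵥ vOneOf (f ∘ U) := by
    intro k
    induction k with
    | zero => simpa using h1
    | succ k ih =>
      rw [pow_succ', ← Matrix.mulVec_mulVec, h2, ih, Matrix.mulVec_mulVec, ← pow_succ']
  ext j i
  exact congrFun (h3 i) j

/-- A real jet whose frame is a basis. -/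
theorem exists_frameOf_det_ne_zero (n : ℕ) :
    ∃ U : FibreIdx n → ℝ, (hessOf U).det ≠ 0 ∧ (frameOf U).det ≠ 0 := by
  classical
  -- The jet of a separable function: gradient (1, …, 1), Hessian 1, and third derivative -a in the
  -- a-th variable. Then v_1 = (1, …, 1) and A = diag(0, …, n-1), so the frame is a Vandermonde
  -- matrix with distinct nodes. Orders above three play no role.
  let U : FibreIdx n → ℝ := fun s => ∑ a : Fin n,
    if ∀ j ∈ s.1, j = a then (if s.1.card = 3 then -((a : ℕ) : ℝ) else 1) else 0
  have e1 : ∀ i, jetFun U (X i) = 1 := by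
    intro i
    have := jetFun_prod_X U ⟨{i}, by simp⟩
    simpa [U] using this
  have e2 : ∀ i j, jetFun U (X i * X j) = if i = j then 1 else 0 := by
    intro i j
    have := jetFun_prod_X U ⟨{i, j}, by simp⟩
    simp only [Multiset.insert_eq_cons, Multiset.map_cons, Multiset.map_singleton,
      Multiset.prod_cons, Multiset.prod_singleton] at this
    rw [this]
    simp only [U]
    rw [Finset.sum_eq_single i (fun a _ h => if_neg fun h' => h (h' i (by simp)).symm) (by simp)]
    by_cases hij : i = j
    · subst hij; simp
    · simp [hij, Ne.symm hij]
  have e3 : ∀ i j k : Fin n, jetFun U (X i * X j * X k) = if i = j ∧ j = k then -((i : ℕ) : ℝ) else 0 := by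
    intro i j k
    have := jetFun_prod_X U ⟨{i, j, k}, by simp⟩
    simp only [Multiset.insert_eq_cons, Multiset.map_cons, Multiset.map_singleton,
      Multiset.prod_cons, Multiset.prod_singleton] at this
    rw [mul_assoc, this]
    simp only [U]
    rw [Finset.sum_eq_single i (fun a _ h => if_neg fun h' => h (h' i (by simp)).symm) (by simp)]
    by_cases hij : i = j
    · subst hij
      by_cases hik : i = k
      · subst hik; simp
      · simp [hik, Ne.symm hik]
    · simp [hij, Ne.symm hij]
  have hh : hessOf U = 1 := by
    ext i j; simp [hessOf, e2, Matrix.one_apply]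
  have hv : vOneOf U = 1 := by
    funext i; simp [vOneOf, hh, lamOf, e1]
  have hA : endoOf U = Matrix.diagonal fun i : Fin n => ((i : ℕ) : ℝ) := by
    ext i j
    simp only [endoOf, hh, inv_one, Matrix.one_mul, Matrix.of_apply, hv, Matrix.diagonal_apply]
    rw [mul_assoc, mul_comm, jetFun_mul_linForm]
    simp only [Pi.one_apply, one_mul, e3]
    by_cases hij : i = j
    · subst hij; simp
    · simp [hij]
  refine ⟨U, by simp [hh], ?_⟩
  have : frameOf U = Matrix.vandermonde fun i : Fin n => ((i : ℕ) : ℝ) := by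
    ext j i
    simp [frameOf, hA, hv, Matrix.diagonal_pow, Matrix.mulVec_diagonal, Matrix.vandermonde]
  rw [this, Matrix.det_vandermonde_ne_zero_iff]
  intro i j hij
  simpa [Fin.ext_iff] using hij

end jets

/-! ### Values of differential functions -/

/-- The fibre coordinates of a jet. -/
def JetPoint.fibre (θ : JetPoint n) : FibreIdx n → ℝ := fun s => θ.u s.1

/-- The jet with given base point and fibre coordinates. -/
def jetPoint (x : Fin n → ℝ) (u : FibreIdx n → ℝ) : JetPoint n where
  x := x
  u s := if h : s ≠ 0 then u ⟨s, h⟩ else 0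

@[simp] theorem jetPoint_x (x : Fin n → ℝ) (u : FibreIdx n → ℝ) : (jetPoint x u).x = x := rfl

@[simp] theorem jetPoint_fibre (x : Fin n → ℝ) (u : FibreIdx n → ℝ) :
    (jetPoint x u).fibre = u := by
  funext s
  exact dif_pos s.2

/-- Evaluation of polynomials at a jet, as a ring homomorphism. -/
def evalJetHom (θ : JetPoint n) : JetPoly n →+* ℝ := eval₂Hom (evalAt θ.x) θ.fibre

theorem evalJet_eq_hom (θ : JetPoint n) (P : JetPoly n) : evalJet θ P = evalJetHom θ P := rfl

theorem evalJet_eq_eval (θ : JetPoint n) (P : JetPoly n) :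
    evalJet θ P = eval θ.fibre (map (evalAt θ.x) P) := by
  rw [eval_map]; rfl

theorem evalJet_mul (θ : JetPoint n) (P Q : JetPoly n) :
    evalJet θ (P * Q) = evalJet θ P * evalJet θ Q := map_mul (evalJetHom θ) P Q

theorem evalJet_add (θ : JetPoint n) (P Q : JetPoly n) :
    evalJet θ (P + Q) = evalJet θ P + evalJet θ Q := map_add (evalJetHom θ) P Q

theorem evalJet_one (θ : JetPoint n) : evalJet θ 1 = 1 := map_one (evalJetHom θ)

theorem SmoothFun.ext_evalAt {a b : SmoothFun n} (h : ∀ x, evalAt x a = evalAt x b) : a = b :=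
  Subtype.ext (funext h)

theorem jetPoly_ext {P P' : JetPoly n} (h : ∀ x, map (evalAt x) P = map (evalAt x) P') :
    P = P' := by
  refine MvPolynomial.ext _ _ fun m => SmoothFun.ext_evalAt fun x => ?_
  rw [← coeff_map, ← coeff_map, h]

/-- Polynomials that agree at the jets where a given denominator does not vanish are equal. -/
theorem jetPoly_ext_of_evalJet (D : denoms n) {P P' : JetPoly n}
    (h : ∀ θ, evalJet θ (D : JetPoly n) ≠ 0 → evalJet θ P = evalJet θ P') : P = P' := by
  refine jetPoly_ext fun x => ?_
  have hD := D.2 x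
  -- Multiplying by the denominator turns agreement off its zero set into agreement at every real
  -- point of the fibre.
  refine mul_left_cancel₀ hD (MvPolynomial.funext fun u => ?_)
  have hx := h (jetPoint x u)
  simp only [evalJet_eq_eval, jetPoint_fibre, jetPoint_x] at hx
  rw [map_mul, map_mul]
  by_cases h0 : eval u (map (evalAt x) (D : JetPoly n)) = 0
  · rw [h0, zero_mul, zero_mul]
  · rw [hx h0]

theorem exists_evalJet_ne_zero (D : denoms n) (x : Fin n → ℝ) :
    ∃ u, evalJet (jetPoint x u) (D : JetPoly n) ≠ 0 := by
  by_contra! h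
  refine D.2 x (MvPolynomial.funext fun u => ?_)
  have := h u
  rw [evalJet_eq_eval, jetPoint_fibre, jetPoint_x] at this
  rw [this, map_zero]

theorem mem_denoms_of_evalJet {P : JetPoly n}
    (h : ∀ x, ∃ θ : JetPoint n, θ.x = x ∧ evalJet θ P ≠ 0) : P ∈ denoms n := by
  intro x hx
  obtain ⟨θ, rfl, hθ⟩ := h x
  rw [evalJet_eq_eval, hx, map_zero] at hθ
  exact hθ rfl

theorem mem_denoms_of_mul_left {P Q : JetPoly n} (h : P * Q ∈ denoms n) : P ∈ denoms n := by
  intro x hx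
  have := h x
  rw [map_mul, hx, zero_mul] at this
  exact this rfl

/-- The smooth functions have zero divisors, but each fibre carries a polynomial ring over ℝ, a
domain, in which a denominator is nonzero. Hence denominators are regular. -/
theorem algebraMap_diffFun_injective :
    Function.Injective (algebraMap (JetPoly n) (DiffFun n)) := by
  refine IsLocalization.injective (M := denoms n) (DiffFun n) fun D hD => ?_
  rw [mem_nonZeroDivisors_iff_right]
  intro P hP
  refine jetPoly_ext fun x => ?_
  have := congrArg (map (evalAt x)) hP
  rw [map_mul, map_zero, mul_eq_zero] at this
  rw [map_zero]
  exact this.resolve_right (hD x)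

theorem quot_eq_quot_iff {P P' : JetPoly n} {Q Q' : denoms n} :
    quot P Q = quot P' Q' ↔ P * (Q' : JetPoly n) = P' * (Q : JetPoly n) := by
  rw [quot, quot, IsLocalization.mk'_eq_iff_eq, algebraMap_diffFun_injective.eq_iff,
    mul_comm, mul_comm P']

theorem quot_mul_quot (P P' : JetPoly n) (Q Q' : denoms n) :
    quot P Q * quot P' Q' = quot (P * P') (Q * Q') := (IsLocalization.mk'_mul _ _ _ _ _).symm

theorem quot_add_quot (P P' : JetPoly n) (Q Q' : denoms n) :
    quot P Q + quot P' Q' = quot (P * (Q' : JetPoly n) + P' * (Q : JetPoly n)) (Q * Q') :=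
  (IsLocalization.mk'_add _ _ _ _).symm

theorem quot_one (P : JetPoly n) : quot P 1 = algebraMap (JetPoly n) (DiffFun n) P :=
  IsLocalization.mk'_one _ _

theorem quot_self (Q : denoms n) : quot (Q : JetPoly n) Q = 1 := IsLocalization.mk'_self' _

theorem exists_eq_quot (f : DiffFun n) : ∃ (P : JetPoly n) (Q : denoms n), f = quot P Q := by
  obtain ⟨P, Q, h⟩ := IsLocalization.exists_mk'_eq (denoms n) f
  exact ⟨P, Q, h.symm⟩

theorem HasValue.unique {f : DiffFun n} {θ : JetPoint n} {c c' : ℝ} (h : HasValue f θ c)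
    (h' : HasValue f θ c') : c = c' := by
  obtain ⟨P, Q, rfl, hQ, rfl⟩ := h
  obtain ⟨P', Q', hf, hQ', rfl⟩ := h'
  rw [quot_eq_quot_iff] at hf
  rw [div_eq_div_iff hQ hQ', ← evalJet_mul, ← evalJet_mul, hf]

theorem hasValue_algebraMap (P : JetPoly n) (θ : JetPoint n) :
    HasValue (algebraMap (JetPoly n) (DiffFun n) P) θ (evalJet θ P) :=
  ⟨P, 1, (quot_one P).symm, by simp [evalJet_one], by simp [evalJet_one]⟩

/-- The pairs of a differential function and its value at `θ`. -/
def valueGraph (θ : JetPoint n) : Subalgebra ℝ (DiffFun n × ℝ) where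
  carrier := {p | HasValue p.1 θ p.2}
  mul_mem' := by
    rintro ⟨f, c⟩ ⟨f', c'⟩ ⟨P, Q, hf, hQ, hc⟩ ⟨P', Q', hf', hQ', hc'⟩
    dsimp only at hf hc hf' hc'
    refine ⟨P * P', Q * Q', ?_, ?_, ?_⟩
    · rw [← quot_mul_quot, ← hf, ← hf']; rfl
    · rw [Submonoid.coe_mul, evalJet_mul]; exact mul_ne_zero hQ hQ'
    · rw [Submonoid.coe_mul, evalJet_mul, evalJet_mul, ← div_mul_div_comm, ← hc, ← hc']; rfl
  add_mem' := by
    rintro ⟨f, c⟩ ⟨f', c'⟩ ⟨P, Q, hf, hQ, hc⟩ ⟨P', Q', hf', hQ', hc'⟩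
    dsimp only at hf hc hf' hc'
    refine ⟨P * (Q' : JetPoly n) + P' * (Q : JetPoly n), Q * Q', ?_, ?_, ?_⟩
    · rw [← quot_add_quot, ← hf, ← hf']; rfl
    · rw [Submonoid.coe_mul, evalJet_mul]; exact mul_ne_zero hQ hQ'
    · rw [Submonoid.coe_mul, evalJet_mul, evalJet_add, evalJet_mul, evalJet_mul]
      change c + c' = _
      rw [hc, hc', div_add_div _ _ hQ hQ']
      ring
  algebraMap_mem' r := by
    have h := hasValue_algebraMap (algebraMap ℝ (JetPoly n) r) θ
    have e : evalJet θ (algebraMap ℝ (JetPoly n) r) = r := by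
      rw [IsScalarTower.algebraMap_apply ℝ (SmoothFun n) (JetPoly n), MvPolynomial.algebraMap_eq,
        evalJet_eq_hom, evalJetHom, coe_eval₂Hom, eval₂_C]
      rfl
    rw [e] at h
    exact h

/-- The function of an element of the graph. -/
def valueGraph.fst (θ : JetPoint n) : valueGraph θ →ₐ[ℝ] DiffFun n :=
  (AlgHom.fst ℝ (DiffFun n) ℝ).comp (valueGraph θ).val

/-- The value of an element of the graph. -/
def valueGraph.snd (θ : JetPoint n) : valueGraph θ →ₐ[ℝ] ℝ :=
  (AlgHom.snd ℝ (DiffFun n) ℝ).comp (valueGraph θ).val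

theorem valueGraph.hasValue {θ : JetPoint n} (e : valueGraph θ) :
    HasValue (valueGraph.fst θ e) θ (valueGraph.snd θ e) := e.2

theorem HasValue.mul {f f' : DiffFun n} {θ : JetPoint n} {c c' : ℝ} (h : HasValue f θ c)
    (h' : HasValue f' θ c') : HasValue (f * f') θ (c * c') :=
  (valueGraph θ).mul_mem (x := (f, c)) (y := (f', c')) h h'

theorem HasValue.sub {f f' : DiffFun n} {θ : JetPoint n} {c c' : ℝ} (h : HasValue f θ c)
    (h' : HasValue f' θ c') : HasValue (f - f') θ (c - c') :=
  (valueGraph θ).sub_mem (x := (f, c)) (y := (f', c')) h h'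

/-- A factor of an admissible denominator is admissible, so the inverse of a unit is the flipped
quotient. -/
theorem mem_denoms_of_quot_mul_eq_one {P : JetPoly n} {Q : denoms n} {h : DiffFun n}
    (e : quot P Q * h = 1) : ∃ hP : P ∈ denoms n, h = quot (Q : JetPoly n) ⟨P, hP⟩ := by
  obtain ⟨P', Q', rfl⟩ := exists_eq_quot h
  rw [quot_mul_quot, ← quot_self 1, quot_eq_quot_iff] at e
  simp only [OneMemClass.coe_one, mul_one, one_mul] at e
  refine ⟨mem_denoms_of_mul_left (Q := P') (e ▸ (Q * Q').2), ?_⟩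
  rw [quot_eq_quot_iff, mul_comm, e]
  rfl

theorem HasValue.inv {f h : DiffFun n} {θ : JetPoint n} {c : ℝ} (hf : HasValue f θ c)
    (hc : c ≠ 0) (e : f * h = 1) : HasValue h θ c⁻¹ := by
  obtain ⟨P, Q, rfl, hQ, rfl⟩ := hf
  obtain ⟨hP, rfl⟩ := mem_denoms_of_quot_mul_eq_one e
  exact ⟨Q, ⟨P, hP⟩, rfl, fun h0 => hc (by simpa using Or.inl h0), by rw [inv_div]⟩

/-- The graph is a ring in which a function and its value are computed together; this lemma makes
h⁻¹ available there. -/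
theorem isUnit_of_valueGraph {θ : JetPoint n} (e : valueGraph θ)
    (hf : IsUnit (valueGraph.fst θ e)) (hc : valueGraph.snd θ e ≠ 0) : IsUnit e := by
  obtain ⟨h, hh⟩ := hf.exists_right_inv
  refine IsUnit.of_mul_eq_one ⟨(h, (valueGraph.snd θ e)⁻¹), (valueGraph.hasValue e).inv hc hh⟩ ?_
  exact Subtype.ext (Prod.ext hh (mul_inv_cancel₀ hc))

/-- A differential function with a nonzero value on each fibre is invertible. -/
theorem isUnit_of_hasValue {f : DiffFun n}
    (h : ∀ x, ∃ (θ : JetPoint n) (c : ℝ), θ.x = x ∧ HasValue f θ c ∧ c ≠ 0) : IsUnit f := by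
  obtain ⟨P, Q, rfl⟩ := exists_eq_quot f
  have hP : P ∈ denoms n := by
    intro x hx
    obtain ⟨θ, c, rfl, ⟨P', Q', hPQ, hQ', rfl⟩, hc⟩ := h x
    rw [quot_eq_quot_iff] at hPQ
    have := congrArg (map (evalAt θ.x)) hPQ
    rw [map_mul, map_mul, hx, zero_mul, eq_comm, mul_eq_zero] at this
    have hP' := this.resolve_right (Q.2 θ.x)
    rw [evalJet_eq_eval, hP', map_zero, zero_div] at hc
    exact hc rfl
  refine IsUnit.of_mul_eq_one (quot (Q : JetPoly n) ⟨P, hP⟩) ?_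
  rw [quot_mul_quot, ← quot_self 1, quot_eq_quot_iff]
  simp [mul_comm]

/-- An invertible differential function has a nonzero value at a generic jet. -/
theorem exists_denom_of_isUnit {f : DiffFun n} (hf : IsUnit f) :
    ∃ D : denoms n, ∀ (θ : JetPoint n) (c : ℝ), evalJet θ (D : JetPoly n) ≠ 0 → HasValue f θ c →
      c ≠ 0 := by
  obtain ⟨P, Q, rfl⟩ := exists_eq_quot f
  obtain ⟨h, e⟩ := hf.exists_right_inv
  obtain ⟨hP, -⟩ := mem_denoms_of_quot_mul_eq_one e
  refine ⟨⟨P, hP⟩ * Q, fun θ c hD hc => ?_⟩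
  rw [Submonoid.coe_mul, evalJet_mul] at hD
  rw [hc.unique ⟨P, Q, rfl, right_ne_zero_of_mul hD, rfl⟩]
  exact div_ne_zero (left_ne_zero_of_mul hD) (right_ne_zero_of_mul hD)

/-- A differential function that vanishes at generic jets is zero. -/
theorem eq_zero_of_hasValue {f : DiffFun n} (D : denoms n)
    (h : ∀ θ, evalJet θ (D : JetPoly n) ≠ 0 → HasValue f θ 0) : f = 0 := by
  obtain ⟨P, Q, rfl⟩ := exists_eq_quot f
  have hP : P = 0 := by
    refine jetPoly_ext_of_evalJet (D * Q) fun θ hθ => ?_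
    rw [Submonoid.coe_mul, evalJet_mul] at hθ
    have h0 := (h θ (left_ne_zero_of_mul hθ)).unique ⟨P, Q, rfl, right_ne_zero_of_mul hθ, rfl⟩
    rw [eq_comm, div_eq_zero_iff] at h0
    rw [h0.resolve_right (right_ne_zero_of_mul hθ), evalJet_eq_hom, map_zero]
  rw [hP, quot, IsLocalization.mk'_zero]

/-! ### The values of the frame -/

/-- The fibre coordinates with their values. -/
def uGraph (θ : JetPoint n) : FibreIdx n → valueGraph θ := fun s =>
  ⟨(uCoord s, θ.fibre s), by
    have h := hasValue_algebraMap (X s) θ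
    have e : evalJet θ (X s) = θ.fibre s := by
      rw [evalJet_eq_hom, evalJetHom, coe_eval₂Hom, eval₂_X]
    rw [e] at h
    exact h⟩

theorem fst_det_hessOf (θ : JetPoint n) :
    valueGraph.fst θ (hessOf (uGraph θ)).det = (hessOf (uCoord (n := n))).det :=
  det_hessOf_map (valueGraph.fst θ : valueGraph θ →+* DiffFun n) (uGraph θ)

theorem snd_det_hessOf (θ : JetPoint n) :
    valueGraph.snd θ (hessOf (uGraph θ)).det = (hessOf θ.fibre).det :=
  det_hessOf_map (valueGraph.snd θ : valueGraph θ →+* ℝ) (uGraph θ)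

theorem isUnit_det_hessOf_uCoord : IsUnit (hessOf (uCoord (n := n))).det := by
  obtain ⟨u, hu, -⟩ := exists_frameOf_det_ne_zero n
  refine isUnit_of_hasValue fun x => ⟨jetPoint x u, (hessOf u).det, rfl, ?_, hu⟩
  have h := valueGraph.hasValue (hessOf (uGraph (jetPoint x u))).det
  rwa [fst_det_hessOf, snd_det_hessOf, jetPoint_fibre] at h

theorem isUnit_det_hessOf_uGraph {θ : JetPoint n} (h : (hessOf θ.fibre).det ≠ 0) :
    IsUnit (hessOf (uGraph θ)).det := by
  refine isUnit_of_valueGraph _ ?_ ?_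
  · rw [fst_det_hessOf]; exact isUnit_det_hessOf_uCoord
  · rwa [snd_det_hessOf]

/-- The frame formed over the graph projects to the generic frame and, in the next lemma, to the
frame of the jet. Thus taking values commutes with forming the frame, without choosing fractions. -/
theorem frameOf_uGraph_fst {θ : JetPoint n} (h : (hessOf θ.fibre).det ≠ 0) :
    (frameOf (uGraph θ)).map (valueGraph.fst θ) = frameOf uCoord :=
  frameOf_map (valueGraph.fst θ : valueGraph θ →+* DiffFun n) (isUnit_det_hessOf_uGraph h)

theorem frameOf_uGraph_snd {θ : JetPoint n} (h : (hessOf θ.fibre).det ≠ 0) :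
    (frameOf (uGraph θ)).map (valueGraph.snd θ) = frameOf θ.fibre :=
  frameOf_map (valueGraph.snd θ : valueGraph θ →+* ℝ) (isUnit_det_hessOf_uGraph h)

theorem hasValue_det_frameOf {θ : JetPoint n} (h : (hessOf θ.fibre).det ≠ 0) :
    HasValue (frameOf (uCoord (n := n))).det θ (frameOf θ.fibre).det := by
  have hv := valueGraph.hasValue (frameOf (uGraph θ)).det
  rw [AlgHom.map_det, AlgHom.map_det, AlgHom.mapMatrix_apply, AlgHom.mapMatrix_apply,
    frameOf_uGraph_fst h, frameOf_uGraph_snd h] at hv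
  exact hv

theorem isUnit_det_frameOf_uCoord : IsUnit (frameOf (uCoord (n := n))).det := by
  obtain ⟨u, hu, hu'⟩ := exists_frameOf_det_ne_zero n
  refine isUnit_of_hasValue fun x => ⟨jetPoint x u, (frameOf u).det, rfl, ?_, hu'⟩
  have h := hasValue_det_frameOf (θ := jetPoint x u) (by rwa [jetPoint_fibre])
  rwa [jetPoint_fibre] at h

/-- The frame of a generic jet is a basis. -/
theorem exists_denom_frameOf : ∃ D : denoms n, ∀ θ : JetPoint n, evalJet θ (D : JetPoly n) ≠ 0 →
    (hessOf θ.fibre).det ≠ 0 ∧ (frameOf θ.fibre).det ≠ 0 := by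
  obtain ⟨D, hD⟩ := exists_denom_of_isUnit (isUnit_det_hessOf_uCoord (n := n))
  obtain ⟨D', hD'⟩ := exists_denom_of_isUnit (isUnit_det_frameOf_uCoord (n := n))
  refine ⟨D * D', fun θ hθ => ?_⟩
  rw [Submonoid.coe_mul, evalJet_mul] at hθ
  have h := valueGraph.hasValue (hessOf (uGraph θ)).det
  rw [fst_det_hessOf, snd_det_hessOf] at h
  have h1 := hD θ _ (left_ne_zero_of_mul hθ) h
  exact ⟨h1, hD' θ _ (right_ne_zero_of_mul hθ) (hasValue_det_frameOf h1)⟩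

/-! ### Derivatives of the symmetric forms -/

/-- The derivation `d` applied to the coefficients of a polynomial. -/
def coeffDeriv {A σ : Type*} [CommRing A] [Algebra ℝ A] (d : Derivation ℝ A A) :
    Derivation ℝ (MvPolynomial σ A) (MvPolynomial σ A) :=
  Derivation.mk'
    { toFun := fun p => AddMonoidAlgebra.map (d : A →+ A) p
      map_add' := fun p q => MvPolynomial.ext _ _ fun m => map_add d (coeff m p) (coeff m q)
      map_smul' := fun c p => MvPolynomial.ext _ _ fun m => d.map_smul c (coeff m p) }
    (fun p q => by
      classical
      refine MvPolynomial.ext _ _ fun m => ?_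
      change d (coeff m (p * q)) = coeff m (p * _ + q * _)
      rw [coeff_add, mul_comm q, coeff_mul, coeff_mul, coeff_mul, map_sum,
        ← Finset.sum_add_distrib]
      refine Finset.sum_congr rfl fun x _ => ?_
      rw [d.leibniz, smul_eq_mul, smul_eq_mul, mul_comm (coeff x.2 q)]
      rfl)

section coeffDeriv

variable {A σ : Type*} [CommRing A] [Algebra ℝ A] (d : Derivation ℝ A A)

theorem coeff_coeffDeriv (m : σ →₀ ℕ) (p : MvPolynomial σ A) :
    coeff m (coeffDeriv d p) = d (coeff m p) := rfl

theorem coeffDeriv_monomial (m : σ →₀ ℕ) (a : A) :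
    coeffDeriv d (monomial m a) = monomial m (d a) := by
  classical
  refine MvPolynomial.ext _ _ fun m' => ?_
  rw [coeff_coeffDeriv, coeff_monomial, coeff_monomial]
  split_ifs <;> simp

@[simp] theorem coeffDeriv_C (a : A) : coeffDeriv d (C a : MvPolynomial σ A) = C (d a) :=
  coeffDeriv_monomial d 0 a

@[simp] theorem coeffDeriv_X (i : σ) : coeffDeriv d (X i : MvPolynomial σ A) = 0 := by
  rw [X, coeffDeriv_monomial]; simp

theorem coeffDeriv_linForm (w : Fin n → A) :
    coeffDeriv d (linForm w) = linForm (d ∘ w) := by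
  simp [linForm_apply, mul_comm]

theorem coeffDeriv_map_algebraMap (p : MvPolynomial σ ℝ) :
    coeffDeriv d (map (algebraMap ℝ A) p) = 0 := by
  refine MvPolynomial.ext _ _ fun m => ?_
  rw [coeff_coeffDeriv, coeff_map, d.map_algebraMap, coeff_zero]

end coeffDeriv

/-- A horizontal vector field as a derivation. -/
def vecDer (w : Fin n → DiffFun n) : Derivation ℝ (DiffFun n) (DiffFun n) :=
  ∑ j, w j • totalD j

theorem vecDer_apply (w : Fin n → DiffFun n) (f : DiffFun n) : vecDer w f = vecAct w f := by
  have h := congrFun (map_sum Derivation.coeFnAddMonoidHom (fun j => w j • totalD j)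
    Finset.univ) f
  rw [Finset.sum_apply] at h
  exact h

/-- The derivative of the symmetric forms along a vector field. -/
theorem vecDer_jetFun (w : Fin n → DiffFun n) {p : MvPolynomial (Fin n) (DiffFun n)}
    (hp : constantCoeff p = 0) : vecDer w (jetFun uCoord p) =
      jetFun uCoord (coeffDeriv (vecDer w) p) + jetFun uCoord (linForm w * p) := by
  -- The functional kills constants, so the Leibniz formula fails on the constant term of `p` by
  -- exactly this correction. With it the identity is additive in `p` and can be checked on
  -- monomials.
  suffices h : vecDer w (jetFun uCoord p) = jetFun uCoord (coeffDeriv (vecDer w) p) +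
      (jetFun uCoord (linForm w * p) - constantCoeff p * jetFun uCoord (linForm w)) by
    rw [h, hp, zero_mul, sub_zero]
  clear hp
  induction p using MvPolynomial.induction_on' with
  | monomial β a =>
    have hm : ∀ b : DiffFun n, monomial β b = C b * ((Finsupp.toMultiset β).map X).prod := by
      intro b
      rw [prod_map_X, Finsupp.toMultiset_toFinsupp, C_mul_monomial, mul_one]
    by_cases h : Finsupp.toMultiset β = 0
    · simp [hm, h, mul_comm, jetFun_C_mul]
    · have hc : constantCoeff (monomial β a) = 0 := by
        rw [constantCoeff_monomial, if_neg]
        rintro rfl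
        simp at h
      rw [hc, zero_mul, sub_zero, coeffDeriv_monomial, hm, hm, jetFun_C_mul, jetFun_C_mul,
        mul_left_comm, jetFun_C_mul, jetFun_prod_X uCoord ⟨_, h⟩, (vecDer w).leibniz, add_comm,
        smul_eq_mul, smul_eq_mul, mul_comm (uCoord _)]
      congr 2
      rw [mul_comm, jetFun_mul_linForm, vecDer_apply, vecAct]
      refine Finset.sum_congr rfl fun j _ => ?_
      rw [totalD_uCoord, ← jetFun_prod_X uCoord, mul_comm]
      simp [FibreIdx.cons, mul_comm]
  | add p q hp hq =>
    simp only [map_add, hp, hq, mul_add]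
    ring

/-! ### The action of the affine group on differential functions -/

/-- The matrix of the inverse of the linear part of `g`. -/
def linInv (g : Aff n) : Matrix (Fin n) (Fin n) ℝ :=
  Matrix.of fun j i => g.linear.symm (Pi.single i 1) j

theorem linInv_eq_toMatrix' (g : Aff n) :
    linInv g = LinearMap.toMatrix' (g.linear.symm : (Fin n → ℝ) →ₗ[ℝ] (Fin n → ℝ)) := by
  ext i j
  rw [LinearMap.toMatrix'_apply]
  simp only [linInv, Matrix.of_apply, LinearEquiv.coe_coe]

theorem isUnit_det_linInv (g : Aff n) : IsUnit (linInv g).det := by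
  rw [linInv_eq_toMatrix', LinearMap.det_toMatrix']
  exact LinearEquiv.isUnit_det' g.linear.symm

/-- An affine map with prescribed linear part and one prescribed value. -/
theorem exists_aff {B : Matrix (Fin n) (Fin n) ℝ} (hB : IsUnit B.det) (x y : Fin n → ℝ) :
    ∃ g : Aff n, linInv g = B ∧ g x = y := by
  let e : (Fin n → ℝ) ≃ₗ[ℝ] (Fin n → ℝ) := (Matrix.toLinearEquiv' B (B.invertibleOfIsUnitDet hB)).symm
  refine ⟨e.toAffineEquiv.trans (AffineEquiv.constVAdd ℝ (Fin n → ℝ) (y - e x)), ?_, ?_⟩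
  · ext i j
    change (e.symm (Pi.single j 1)) i = _
    change (Matrix.toLin' B (Pi.single j 1)) i = _
    simp
  · simp

theorem act_x (g : Aff n) (θ : JetPoint n) : (θ.act g).x = g θ.x := rfl

/-- The product of forms attached to a nonempty index has no constant term, so the coordinate u
itself never enters and the action is a change of frame. -/
theorem act_fibre (g : Aff n) (θ : JetPoint n) :
    (θ.act g).fibre = substJet θ.fibre (linInv g) := by
  funext s
  have h : (s.1.map (dualForm g)).prod = colProd (linInv g) s.1 := rfl
  change ∑ β ∈ (s.1.map (dualForm g)).prod.support,
    (s.1.map (dualForm g)).prod.coeff β * θ.u (Finsupp.toMultiset β) = _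
  rw [h, substJet]
  conv_rhs => rw [(colProd (linInv g) s.1).as_sum]
  rw [map_sum]
  refine Finset.sum_congr rfl fun β hβ => ?_
  rw [jetFun_monomial]
  congr 1
  have hne : Finsupp.toMultiset β ≠ 0 := by
    rintro h0
    have : β = 0 := by rw [← Finsupp.toMultiset_toFinsupp β, h0, map_zero]
    subst this
    rw [mem_support_iff] at hβ
    exact hβ (constantCoeff_colProd (linInv g) s)
  rw [dif_pos hne]
  rfl

theorem aff_contDiff (g : Aff n) : ContDiff ℝ ∞ (g : (Fin n → ℝ) → (Fin n → ℝ)) := by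
  have h : (g : (Fin n → ℝ) → (Fin n → ℝ)) =
      fun x => (g.linear : (Fin n → ℝ) →ₗ[ℝ] (Fin n → ℝ)).toContinuousLinearMap x + g 0 :=
    AffineMap.decomp (g : (Fin n → ℝ) →ᵃ[ℝ] (Fin n → ℝ))
  rw [h]
  exact (ContinuousLinearMap.contDiff _).add contDiff_const

theorem aff_hasFDerivAt (g : Aff n) (x : Fin n → ℝ) : HasFDerivAt g
    (g.linear : (Fin n → ℝ) →ₗ[ℝ] (Fin n → ℝ)).toContinuousLinearMap x := by
  have h : (g : (Fin n → ℝ) → (Fin n → ℝ)) =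
      fun x => (g.linear : (Fin n → ℝ) →ₗ[ℝ] (Fin n → ℝ)).toContinuousLinearMap x + g 0 :=
    AffineMap.decomp (g : (Fin n → ℝ) →ᵃ[ℝ] (Fin n → ℝ))
  rw [h]
  exact (ContinuousLinearMap.hasFDerivAt _).add_const _

/-- `a ↦ a ∘ g` on smooth functions. -/
def pullSmooth (g : Aff n) : SmoothFun n →+* SmoothFun n where
  toFun a := ⟨a.1 ∘ g, by
    have ha : ContDiff ℝ ∞ a.1 := a.2
    exact ha.comp (aff_contDiff g)⟩
  map_one' := rfl
  map_zero' := rfl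
  map_add' _ _ := rfl
  map_mul' _ _ := rfl

theorem evalAt_pullSmooth (g : Aff n) (a : SmoothFun n) (x : Fin n → ℝ) :
    evalAt x (pullSmooth g a) = evalAt (g x) a := rfl

theorem evalAt_algebraMap (x : Fin n → ℝ) (c : ℝ) : evalAt x (algebraMap ℝ (SmoothFun n) c) = c :=
  rfl

/-- `P ↦ P ∘ g` on polynomials. -/
def pullPoly (g : Aff n) : JetPoly n →+* JetPoly n :=
  eval₂Hom (C.comp (pullSmooth g))
    (substJet X ((linInv g).map (algebraMap ℝ (JetPoly n))))

theorem evalJet_pullPoly (g : Aff n) (θ : JetPoint n) (P : JetPoly n) :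
    evalJet θ (pullPoly g P) = evalJet (θ.act g) P := by
  have h : (evalJetHom θ).comp (pullPoly g) = evalJetHom (θ.act g) := by
    refine MvPolynomial.ringHom_ext (fun a => ?_) fun s => ?_
    · simp [evalJetHom, pullPoly, evalAt_pullSmooth, act_x]
    · have h1 : evalJetHom θ ∘ (X : FibreIdx n → JetPoly n) = θ.fibre := by
        funext s; simp [evalJetHom]
      have h2 : ((linInv g).map (algebraMap ℝ (JetPoly n))).map (evalJetHom θ) = linInv g := by
        ext i j
        change eval₂ _ _ (C _) = _
        rw [eval₂_C]
        rfl
      have h3 := congrFun (map_substJet (evalJetHom θ) X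
        ((linInv g).map (algebraMap ℝ (JetPoly n)))) s
      rw [h1, h2, Function.comp_apply] at h3
      simpa [evalJetHom, pullPoly, act_fibre] using h3
  exact congrArg (fun φ : JetPoly n →+* ℝ => φ P) h

/-- The action maps the fibre over x bijectively onto the fibre over g x, so a jet where `Q` does
not vanish can be moved back. -/
theorem pullPoly_mem_denoms (g : Aff n) (Q : denoms n) : pullPoly g (Q : JetPoly n) ∈ denoms n := by
  refine mem_denoms_of_evalJet fun x => ?_
  obtain ⟨u, hu⟩ := exists_evalJet_ne_zero Q (g x)
  refine ⟨jetPoint x (substJet u (linInv g)⁻¹), rfl, ?_⟩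
  have h : ((jetPoint x (substJet u (linInv g)⁻¹)).act g).fibre = u := by
    rw [act_fibre, jetPoint_fibre, substJet_substJet,
      Matrix.nonsing_inv_mul _ (isUnit_det_linInv g), substJet_one]
  rw [evalJet_pullPoly, evalJet_eq_eval, h]
  rwa [evalJet_eq_eval, jetPoint_fibre] at hu

/-- The pull-back `g^*` of differential functions. -/
def pull (g : Aff n) : DiffFun n →+* DiffFun n :=
  IsLocalization.map (M := denoms n) (T := denoms n) (DiffFun n) (pullPoly g)
    fun Q hQ => pullPoly_mem_denoms g ⟨Q, hQ⟩

theorem pull_quot (g : Aff n) (P : JetPoly n) (Q : denoms n) :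
    pull g (quot P Q) = quot (pullPoly g P) ⟨pullPoly g Q, pullPoly_mem_denoms g Q⟩ :=
  IsLocalization.map_mk' _ _ _

theorem pull_algebraMap (g : Aff n) (P : JetPoly n) :
    pull g (algebraMap (JetPoly n) (DiffFun n) P) =
      algebraMap (JetPoly n) (DiffFun n) (pullPoly g P) := IsLocalization.map_eq _ _

theorem HasValue.pull {g : Aff n} {f : DiffFun n} {θ : JetPoint n} {c : ℝ}
    (h : HasValue f (θ.act g) c) : HasValue (pull g f) θ c := by
  obtain ⟨P, Q, rfl, hQ, rfl⟩ := h
  refine ⟨_, _, pull_quot g P Q, ?_, ?_⟩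
  · rwa [evalJet_pullPoly]
  · rw [evalJet_pullPoly, evalJet_pullPoly]

/-- A product of denominators is again a denominator, so quotients that agree wherever both are
defined have equal cross products. From here on invariance means being fixed by a ring homomorphism.
-/
theorem isPullback_iff {g : Aff n} {f f' : DiffFun n} : IsPullback g f f' ↔ pull g f = f' := by
  constructor
  · intro h
    obtain ⟨P, Q, rfl⟩ := exists_eq_quot f
    obtain ⟨P', Q', rfl⟩ := exists_eq_quot f'
    rw [pull_quot, quot_eq_quot_iff]
    refine jetPoly_ext_of_evalJet (Q' * ⟨pullPoly g Q, pullPoly_mem_denoms g Q⟩) fun θ hθ => ?_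
    rw [Submonoid.coe_mul, evalJet_mul] at hθ
    have h1 := left_ne_zero_of_mul hθ
    have h2 := right_ne_zero_of_mul hθ
    dsimp only at h2 ⊢
    rw [evalJet_mul, evalJet_mul]
    rw [evalJet_pullPoly] at h2 ⊢
    rw [evalJet_pullPoly, ← div_eq_div_iff h2 h1]
    exact h θ _ _ ⟨P, Q, rfl, h2, rfl⟩ ⟨P', Q', rfl, h1, rfl⟩
  · rintro rfl θ c c' hc hc'
    exact hc.pull.unique hc'

theorem isDiffInvariant_iff {f : DiffFun n} : IsDiffInvariant f ↔ ∀ g, pull g f = f := by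
  simp only [IsDiffInvariant, isPullback_iff]

theorem pull_ofSmooth (g : Aff n) (a : SmoothFun n) :
    pull g (ofSmooth a) = ofSmooth (pullSmooth g a) := by
  have h (b : SmoothFun n) : ofSmooth b = algebraMap (JetPoly n) (DiffFun n) (C b) := rfl
  rw [h, h, pull_algebraMap, pullPoly, coe_eval₂Hom, eval₂_C, RingHom.comp_apply]

theorem ofSmooth_algebraMap (c : ℝ) :
    ofSmooth (algebraMap ℝ (SmoothFun n) c) = algebraMap ℝ (DiffFun n) c := by
  rw [IsScalarTower.algebraMap_apply ℝ (JetPoly n) (DiffFun n), MvPolynomial.algebraMap_apply, ofSmooth,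
    RingHom.comp_apply]

theorem pull_algebraMap_real (g : Aff n) (c : ℝ) :
    pull g (algebraMap ℝ (DiffFun n) c) = algebraMap ℝ (DiffFun n) c := by
  have h : pullSmooth g (algebraMap ℝ (SmoothFun n) c) = algebraMap ℝ (SmoothFun n) c :=
    SmoothFun.ext_evalAt fun x => rfl
  rw [← ofSmooth_algebraMap, pull_ofSmooth, h]

/-- The matrix `linInv g` over the differential functions. -/
def linInvD (g : Aff n) : Matrix (Fin n) (Fin n) (DiffFun n) :=
  (linInv g).map (algebraMap ℝ (DiffFun n))

theorem isUnit_det_linInvD (g : Aff n) : IsUnit (linInvD g).det := by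
  have h := (isUnit_det_linInv g).map (algebraMap ℝ (DiffFun n))
  rwa [RingHom.map_det] at h

theorem pull_comp_uCoord (g : Aff n) : pull g ∘ uCoord = substJet uCoord (linInvD g) := by
  have h := map_substJet (algebraMap (JetPoly n) (DiffFun n)) X
    ((linInv g).map (algebraMap ℝ (JetPoly n)))
  rw [Matrix.map_map] at h
  refine Eq.trans ?_ h
  funext s
  change pull g (algebraMap (JetPoly n) (DiffFun n) (X s)) = _
  rw [pull_algebraMap, pullPoly, coe_eval₂Hom, eval₂_X]
  rfl

theorem pull_uCoord (g : Aff n) (s : FibreIdx n) :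
    pull g (uCoord s) = substJet uCoord (linInvD g) s := congrFun (pull_comp_uCoord g) s

theorem pull_partialX (g : Aff n) (i : Fin n) (a : SmoothFun n) :
    pullSmooth g (partialX i a) =
      ∑ j, algebraMap ℝ (SmoothFun n) (linInv g j i) * partialX j (pullSmooth g a) := by
  refine SmoothFun.ext_evalAt fun x => ?_
  have ha : ContDiff ℝ ∞ a.1 := a.2
  have hd : DifferentiableAt ℝ a.1 (g x) := ha.differentiable (by simp) _
  have h2 : ∀ v, fderiv ℝ (a.1 ∘ g) x v = fderiv ℝ a.1 (g x) (g.linear v) := by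
    intro v
    rw [(hd.hasFDerivAt.comp x (aff_hasFDerivAt g x)).fderiv]
    rfl
  rw [map_sum]
  simp only [map_mul, evalAt_algebraMap]
  change fderiv ℝ a.1 (g x) (Pi.single i 1) =
    ∑ j, linInv g j i * fderiv ℝ (a.1 ∘ g) x (Pi.single j 1)
  have h3 : (Pi.single i 1 : Fin n → ℝ) = g.linear (∑ j, linInv g j i • Pi.single j 1) := by
    have : (∑ j, linInv g j i • (Pi.single j 1 : Fin n → ℝ)) = g.linear.symm (Pi.single i 1) := by
      funext k
      simp [linInv, Finset.sum_apply, Pi.single_apply]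
    rw [this, LinearEquiv.apply_symm_apply]
  conv_lhs => rw [h3]
  simp only [map_sum, map_smul, h2, smul_eq_mul]

/-- The chain rule. It holds on smooth functions and on the u_s, extends to polynomials by the
Leibniz rule, and passes to P/Q by differentiating P = (P/Q)·Q and cancelling the unit Q. -/
theorem pull_totalD (g : Aff n) (i : Fin n) (f : DiffFun n) :
    pull g (totalD i f) = ∑ j, linInvD g j i * totalD j (pull g f) := by
  have e : ∀ f, ∑ j, linInvD g j i * totalD j f = vecDer ((linInvD g).col i) f := by
    intro f; rw [vecDer_apply]; rfl
  rw [e]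
  have hmul : ∀ f f' : DiffFun n, pull g (totalD i f) = vecDer ((linInvD g).col i) (pull g f) →
      pull g (totalD i f') = vecDer ((linInvD g).col i) (pull g f') →
      pull g (totalD i (f * f')) = vecDer ((linInvD g).col i) (pull g (f * f')) := by
    intro f f' h h'
    rw [Derivation.leibniz, map_add, smul_eq_mul, smul_eq_mul, map_mul, map_mul, h, h', map_mul,
      Derivation.leibniz, smul_eq_mul, smul_eq_mul]
  have hpoly : ∀ P : JetPoly n, pull g (totalD i (algebraMap _ (DiffFun n) P)) =
      vecDer ((linInvD g).col i) (pull g (algebraMap _ (DiffFun n) P)) := by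
    intro P
    induction P using MvPolynomial.induction_on with
    | C a =>
      change pull g (totalD i (ofSmooth a)) = vecDer _ (pull g (ofSmooth a))
      rw [totalD_ofSmooth, pull_ofSmooth, pull_ofSmooth, pull_partialX, map_sum, ← e]
      refine Finset.sum_congr rfl fun j _ => ?_
      rw [map_mul, totalD_ofSmooth]
      rfl
    | add P Q hP hQ => simp only [map_add, hP, hQ]
    | mul_X P s hP =>
      rw [map_mul]
      refine hmul _ _ hP ?_
      change pull g (totalD i (uCoord s)) = vecDer _ (pull g (uCoord s))
      rw [totalD_uCoord, pull_uCoord, pull_uCoord, substJet, substJet,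
        vecDer_jetFun _ (constantCoeff_colProd _ s)]
      -- The linear part of `g` has constant real entries, so only the jet variables are
      -- differentiated.
      have h0 : coeffDeriv (vecDer ((linInvD g).col i)) (colProd (linInvD g) s.1) = 0 := by
        rw [linInvD, ← map_colProd, coeffDeriv_map_algebraMap]
      rw [h0, map_zero, zero_add, colProd, colProd, FibreIdx.cons, Multiset.map_cons,
        Multiset.prod_cons]
  obtain ⟨P, Q, rfl⟩ := exists_eq_quot f
  have hQ := hpoly (Q : JetPoly n)
  have hP := hpoly P
  have hPQ : algebraMap (JetPoly n) (DiffFun n) P =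
      quot P Q * algebraMap (JetPoly n) (DiffFun n) Q := (IsLocalization.mk'_spec _ _ _).symm
  rw [hPQ, Derivation.leibniz, map_mul, Derivation.leibniz] at hP
  simp only [map_add, smul_eq_mul, map_mul, hQ] at hP
  have hu : IsUnit (pull g (algebraMap (JetPoly n) (DiffFun n) Q)) :=
    (IsLocalization.map_units (DiffFun n) Q).map (pull g)
  exact hu.mul_left_cancel (add_left_cancel hP)

theorem pull_vecAct (g : Aff n) (w : Fin n → DiffFun n) (f : DiffFun n) :
    pull g (vecAct w f) = vecAct (linInvD g *ᵥ (pull g ∘ w)) (pull g f) := by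
  simp only [vecAct, map_sum, map_mul, pull_totalD, Matrix.mulVec, dotProduct, Finset.mul_sum,
    Finset.sum_mul, Function.comp_apply]
  rw [Finset.sum_comm]
  refine Finset.sum_congr rfl fun j _ => Finset.sum_congr rfl fun k _ => ?_
  ring

theorem pull_jetFun (g : Aff n) (p : MvPolynomial (Fin n) (DiffFun n)) :
    pull g (jetFun uCoord p) =
      jetFun uCoord (aeval (fun i => linForm ((linInvD g).col i)) (map (pull g) p)) := by
  rw [map_jetFun, pull_comp_uCoord, jetFun_substJet]

/-- The invariance of the v_i: pulling back the components and transforming them by the linear part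
gives the same fields. -/
theorem linInvD_mul_frameOf (g : Aff n) :
    linInvD g * (frameOf uCoord).map (pull g) = frameOf uCoord := by
  rw [frameOf_map _ isUnit_det_hessOf_uCoord, pull_comp_uCoord,
    mul_frameOf_substJet isUnit_det_hessOf_uCoord (isUnit_det_linInvD g)]

theorem linInvD_mulVec_frameOf (g : Aff n) (i : Fin n) :
    linInvD g *ᵥ (pull g ∘ (frameOf uCoord).col i) = (frameOf uCoord).col i := by
  conv_rhs => rw [← linInvD_mul_frameOf g]
  rfl

/-! ### Central moments of low order -/

theorem hess_eq_hessOf (n : ℕ) : hess n = hessOf uCoord := by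
  ext i j
  have h := jetFun_prod_X uCoord (FibreIdx.cons j ⟨{i}, Multiset.singleton_ne_zero i⟩)
  simp only [FibreIdx.cons, Multiset.map_cons, Multiset.map_singleton, Multiset.prod_cons,
    Multiset.prod_singleton] at h
  simp only [hess, hessOf, Matrix.of_apply, lam, totalD_uCoord, FibreIdx.cons]
  rw [← h, mul_comm]

theorem lam_eq_lamOf : (lam : Fin n → DiffFun n) = lamOf uCoord := by
  funext i
  have h := jetFun_prod_X uCoord (⟨{i}, Multiset.singleton_ne_zero i⟩ : FibreIdx n)
  simp only [Multiset.map_singleton, Multiset.prod_singleton] at h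
  rw [lam, lamOf, h]

theorem vecAct_lam (w : Fin n → DiffFun n) (i : Fin n) :
    vecAct w (lam i) = (hessOf uCoord *ᵥ w) i := by
  rw [← hess_eq_hessOf]
  simp [vecAct, hess, Matrix.mulVec, dotProduct, mul_comm]

/-- The derivation `∂/∂λᵢ`. -/
def dLamDer (i : Fin n) : Derivation ℝ (DiffFun n) (DiffFun n) := vecDer ((hess n)⁻¹.col i)

theorem dLam_eq_dLamDer (i : Fin n) (f : DiffFun n) : dLam i f = dLamDer i f := by
  rw [dLamDer, vecDer_apply]; rfl

/-- This is w = ∑ dλ_i(w) ∂_{λ_i}. It turns contractions with dλ into derivatives along `w`, so h⁻¹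
never has to be differentiated. -/
theorem sum_hessOf_mul_dLamDer (w : Fin n → DiffFun n) (f : DiffFun n) :
    ∑ i, (hessOf uCoord *ᵥ w) i * dLamDer i f = vecDer w f := by
  have h : (hess n)⁻¹ *ᵥ (hessOf uCoord *ᵥ w) = w := by
    rw [hess_eq_hessOf, Matrix.mulVec_mulVec, Matrix.nonsing_inv_mul _ isUnit_det_hessOf_uCoord,
      Matrix.one_mulVec]
  conv_rhs => rw [← h]
  simp only [dLamDer, vecDer_apply, vecAct, Finset.mul_sum]
  rw [Finset.sum_comm]
  refine Finset.sum_congr rfl fun j _ => ?_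
  rw [Matrix.mulVec, dotProduct, Finset.sum_mul]
  refine Finset.sum_congr rfl fun i _ => ?_
  rw [Matrix.col_apply]
  ring

theorem vecDer_xFun (w : Fin n → DiffFun n) (i : Fin n) : vecDer w (ofSmooth (xFun i)) = w i := by
  classical
  have h : ∀ j : Fin n, partialX j (xFun i) = algebraMap ℝ (SmoothFun n) (if j = i then 1 else 0) := by
    intro j
    refine SmoothFun.ext_evalAt fun x => ?_
    rw [evalAt_algebraMap]
    change fderiv ℝ (fun x : Fin n → ℝ => x i) x (Pi.single j 1) = _
    rw [(hasFDerivAt_apply i x).fderiv]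
    simp [Pi.single_apply, eq_comm]
  rw [vecDer_apply, vecAct, Finset.sum_eq_single i]
  · rw [totalD_ofSmooth, h]; simp
  · intro j _ hj
    rw [totalD_ofSmooth, h, if_neg hj, map_zero, map_zero, mul_zero]
  · simp

/-- The second central moment. -/
def covar (i j : Fin n) : DiffFun n := dLamDer i (ofSmooth (xFun j))

theorem moment_one (i : Fin n) : moment [i] = ofSmooth (xFun i) := by
  simp [moment, dLam]

theorem moment_two (i j : Fin n) :
    moment [i, j] = ofSmooth (xFun i) * ofSmooth (xFun j) + covar i j := by
  rw [moment, moment_one, dLam_eq_dLamDer, covar]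

/-- The x^i are the first λ-derivatives of log Z, so the further derivatives are its cumulants, and
this is the moment-cumulant expansion. -/
theorem moment_three (i j k : Fin n) :
    moment [i, j, k] = ofSmooth (xFun i) * ofSmooth (xFun j) * ofSmooth (xFun k) +
      ofSmooth (xFun i) * covar j k + ofSmooth (xFun j) * covar i k +
      ofSmooth (xFun k) * covar i j + dLamDer i (covar j k) := by
  rw [moment, moment_two, dLam_eq_dLamDer, map_add, Derivation.leibniz]
  simp only [smul_eq_mul, covar]
  ring

theorem moment_four (i j k l : Fin n) :
    moment [i, j, k, l] = ofSmooth (xFun i) * moment [j, k, l] +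
      ofSmooth (xFun j) * ofSmooth (xFun k) * covar i l +
      ofSmooth (xFun j) * ofSmooth (xFun l) * covar i k +
      ofSmooth (xFun k) * ofSmooth (xFun l) * covar i j +
      covar i j * covar k l + covar i k * covar j l + covar i l * covar j k +
      ofSmooth (xFun j) * dLamDer i (covar k l) + ofSmooth (xFun k) * dLamDer i (covar j l) +
      ofSmooth (xFun l) * dLamDer i (covar j k) + dLamDer i (dLamDer j (covar k l)) := by
  have e : ∀ m : Fin n, dLamDer i (ofSmooth (xFun m)) = covar i m := fun _ => rfl
  rw [moment, dLam_eq_dLamDer, moment_three]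
  simp only [map_add, Derivation.leibniz, smul_eq_mul, e]
  ring

/-- A product over all slots, unlike one over a complement, can be expanded factor by factor for a
given `k`. -/
theorem centralMoment_eq {k : ℕ} (τ : Fin k → Fin n) :
    centralMoment τ = ∑ S : Finset (Fin k), (-1) ^ (k - S.card) *
      moment (((List.finRange k).filter (fun a => a ∈ S)).map τ) *
        ∏ a, if a ∈ S then 1 else ofSmooth (xFun (τ a)) := by
  refine Finset.sum_congr rfl fun S _ => ?_
  congr 1
  rw [← Finset.prod_filter_mul_prod_filter_not Finset.univ (· ∈ S)]
  rw [Finset.prod_congr rfl (g := fun _ => (1 : DiffFun n))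
    (fun a ha => if_pos (Finset.mem_filter.1 ha).2), Finset.prod_const_one, one_mul]
  have : Finset.univ.filter (fun a => a ∉ S) = Sᶜ := by ext a; simp
  rw [this]
  refine Finset.prod_congr rfl fun a ha => ?_
  rw [if_neg (Finset.mem_compl.1 ha), moment_one]

theorem centralMoment_two (τ : Fin 2 → Fin n) : centralMoment τ = covar (τ 0) (τ 1) := by
  have h : (Finset.univ : Finset (Finset (Fin 2))) = {∅, {0}, {1}, {0, 1}} := by decide
  rw [centralMoment_eq, h]
  repeat rw [Finset.sum_insert (by decide)]
  rw [Finset.sum_singleton]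
  simp only [Fin.prod_univ_two, show List.finRange 2 = [0, 1] from rfl]
  simp [moment_two, moment_one, show moment [] = (1 : DiffFun n) from rfl]
  ring

theorem centralMoment_three (τ : Fin 3 → Fin n) :
    centralMoment τ = dLamDer (τ 0) (covar (τ 1) (τ 2)) := by
  have h : (Finset.univ : Finset (Finset (Fin 3))) =
      {∅, {0}, {1}, {2}, {0, 1}, {0, 2}, {1, 2}, {0, 1, 2}} := by decide
  rw [centralMoment_eq, h]
  repeat rw [Finset.sum_insert (by decide)]
  rw [Finset.sum_singleton]
  simp only [Fin.prod_univ_three, show List.finRange 3 = [0, 1, 2] from rfl]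
  simp [moment_three, moment_two, moment_one, show moment [] = (1 : DiffFun n) from rfl]
  ring

/-- Order four is the first where a central moment differs from the cumulant: the three pairings of
covariances appear. -/
theorem centralMoment_four (τ : Fin 4 → Fin n) :
    centralMoment τ = dLamDer (τ 0) (dLamDer (τ 1) (covar (τ 2) (τ 3))) +
      covar (τ 0) (τ 1) * covar (τ 2) (τ 3) + covar (τ 0) (τ 2) * covar (τ 1) (τ 3) +
      covar (τ 0) (τ 3) * covar (τ 1) (τ 2) := by
  have h : (Finset.univ : Finset (Finset (Fin 4))) =
      {∅, {0}, {1}, {2}, {3}, {0, 1}, {0, 2}, {0, 3}, {1, 2}, {1, 3}, {2, 3}, {0, 1, 2},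
        {0, 1, 3}, {0, 2, 3}, {1, 2, 3}, {0, 1, 2, 3}} := by decide
  rw [centralMoment_eq, h]
  repeat rw [Finset.sum_insert (by decide)]
  rw [Finset.sum_singleton]
  simp only [Fin.prod_univ_four, show List.finRange 4 = [0, 1, 2, 3] from rfl]
  simp [moment_four, moment_three, moment_two, moment_one,
    show moment [] = (1 : DiffFun n) from rfl]
  ring

/-! ### The forms `σ₂`, `σ₃`, `σ₄` -/

/-- The vector `h⁻¹ u₃(w, w', ·)`. -/
def crossVec (w w' : Fin n → DiffFun n) : Fin n → DiffFun n :=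
  (hessOf uCoord)⁻¹ *ᵥ fun i => jetFun uCoord (linForm w * linForm w' * X i)

theorem hessOf_mulVec_crossVec (w w' : Fin n → DiffFun n) (i : Fin n) :
    (hessOf uCoord *ᵥ crossVec w w') i = jetFun uCoord (linForm w * linForm w' * X i) := by
  rw [crossVec, Matrix.mulVec_mulVec, Matrix.mul_nonsing_inv _ isUnit_det_hessOf_uCoord,
    Matrix.one_mulVec]

theorem jetFun_crossVec_mul (w w' y : Fin n → DiffFun n) :
    jetFun uCoord (linForm (crossVec w w') * linForm y) =
      jetFun uCoord (linForm w * linForm w' * linForm y) := by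
  rw [jetFun_mul_linForm, jetFun_mul_linForm]
  simp only [jetFun_linForm_mul_X, hessOf_mulVec_crossVec]

theorem constantCoeff_linForm_mul {R : Type*} [CommRing R] (w : Fin n → R)
    (p : MvPolynomial (Fin n) R) : constantCoeff (linForm w * p) = 0 := by
  rw [map_mul, constantCoeff_linForm, zero_mul]

/-- Differentiating the λ-components h w' instead of the x-components w' costs the extra term u_3(w,
w', ·) = h(`crossVec w w'`). -/
theorem vecDer_hessOf_mulVec (w w' : Fin n → DiffFun n) (i : Fin n) :
    vecDer w ((hessOf uCoord *ᵥ w') i) =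
      (hessOf uCoord *ᵥ (vecDer w ∘ w' + crossVec w w')) i := by
  rw [← jetFun_linForm_mul_X, vecDer_jetFun w (constantCoeff_linForm_mul _ _), Matrix.mulVec_add,
    Pi.add_apply, hessOf_mulVec_crossVec, ← jetFun_linForm_mul_X, Derivation.leibniz,
    coeffDeriv_X, coeffDeriv_linForm, smul_zero, zero_add, smul_eq_mul, mul_comm (X i), mul_assoc]

theorem vecDer_jetFun_two (w a b : Fin n → DiffFun n) :
    vecDer w (jetFun uCoord (linForm a * linForm b)) =
      jetFun uCoord (linForm (vecDer w ∘ a) * linForm b) +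
      jetFun uCoord (linForm a * linForm (vecDer w ∘ b)) +
      jetFun uCoord (linForm w * linForm a * linForm b) := by
  rw [vecDer_jetFun w (constantCoeff_linForm_mul _ _), Derivation.leibniz]
  simp only [coeffDeriv_linForm, smul_eq_mul, map_add]
  rw [mul_comm (linForm b), mul_assoc]
  ring

theorem vecDer_jetFun_three (w a b c : Fin n → DiffFun n) :
    vecDer w (jetFun uCoord (linForm a * linForm b * linForm c)) =
      jetFun uCoord (linForm (vecDer w ∘ a) * linForm b * linForm c) +
      jetFun uCoord (linForm a * linForm (vecDer w ∘ b) * linForm c) +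
      jetFun uCoord (linForm a * linForm b * linForm (vecDer w ∘ c)) +
      jetFun uCoord (linForm w * linForm a * linForm b * linForm c) := by
  rw [vecDer_jetFun w (by rw [mul_assoc]; exact constantCoeff_linForm_mul _ _),
    Derivation.leibniz, Derivation.leibniz, ← map_add, ← map_add, ← map_add, ← map_add]
  simp only [coeffDeriv_linForm, smul_eq_mul]
  congr 1
  ring

/-- The reason for σ_2 = u_2: contracting the first index with dλ(a) differentiates x^j along `a`,
which gives a^j. -/
theorem sum_covar (a b : Fin n → DiffFun n) :
    ∑ i, ∑ j, (hessOf uCoord *ᵥ a) i * (hessOf uCoord *ᵥ b) j * covar i j =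
      jetFun uCoord (linForm a * linForm b) := by
  rw [mul_comm, jetFun_mul_linForm, Finset.sum_comm]
  refine Finset.sum_congr rfl fun j _ => ?_
  rw [jetFun_linForm_mul_X, ← vecDer_xFun a j, ← sum_hessOf_mul_dLamDer, Finset.sum_mul]
  refine Finset.sum_congr rfl fun i _ => ?_
  rw [covar]
  ring

/-- Differentiate `sum_covar`. The right side produces u_3(w, a, b) once and the two factors h a, h
b on the left produce it twice; the difference is the sign in σ_3 = -u_3. -/
theorem sum_vecDer_covar (w a b : Fin n → DiffFun n) :
    ∑ i, ∑ j, (hessOf uCoord *ᵥ a) i * (hessOf uCoord *ᵥ b) j * vecDer w (covar i j) =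
      -jetFun uCoord (linForm w * linForm a * linForm b) := by
  have h := vecDer_jetFun_two w a b
  rw [← sum_covar a b] at h
  simp only [map_sum, Derivation.leibniz, smul_eq_mul, vecDer_hessOf_mulVec] at h
  have e : ∀ i j : Fin n, (hessOf uCoord *ᵥ a) i * (hessOf uCoord *ᵥ b) j * vecDer w (covar i j) +
      covar i j * ((hessOf uCoord *ᵥ a) i * (hessOf uCoord *ᵥ (vecDer w ∘ b + crossVec w b)) j +
        (hessOf uCoord *ᵥ b) j * (hessOf uCoord *ᵥ (vecDer w ∘ a + crossVec w a)) i) =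
      (hessOf uCoord *ᵥ a) i * (hessOf uCoord *ᵥ b) j * vecDer w (covar i j) +
      (hessOf uCoord *ᵥ a) i * (hessOf uCoord *ᵥ (vecDer w ∘ b + crossVec w b)) j * covar i j +
      (hessOf uCoord *ᵥ (vecDer w ∘ a + crossVec w a)) i * (hessOf uCoord *ᵥ b) j * covar i j := by
    intro i j; ring
  simp only [e, Finset.sum_add_distrib, sum_covar] at h
  rw [mul_comm (linForm a) (linForm _)] at h
  simp only [map_add, add_mul, jetFun_crossVec_mul] at h
  rw [mul_comm (linForm a) (linForm (vecDer w ∘ b)), mul_right_comm (linForm w) (linForm b)] at h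
  linear_combination h

theorem sum_dLamDer_covar (a b c : Fin n → DiffFun n) :
    ∑ i, ∑ j, ∑ k, (hessOf uCoord *ᵥ a) i * (hessOf uCoord *ᵥ b) j * (hessOf uCoord *ᵥ c) k *
      dLamDer i (covar j k) = -jetFun uCoord (linForm a * linForm b * linForm c) := by
  rw [← sum_vecDer_covar]
  simp only [← sum_hessOf_mul_dLamDer a, Finset.mul_sum]
  rw [Finset.sum_comm]
  refine Finset.sum_congr rfl fun j _ => ?_
  rw [Finset.sum_comm]
  refine Finset.sum_congr rfl fun k _ => Finset.sum_congr rfl fun i _ => ?_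
  ring

/-- The same argument applied to `sum_dLamDer_covar`. The derivatives of the vector fields cancel,
leaving -u_4 and one correction for each slot. -/
theorem sum_vecDer_dLamDer_covar (w a b c : Fin n → DiffFun n) :
    ∑ i, ∑ j, ∑ k, (hessOf uCoord *ᵥ a) i * (hessOf uCoord *ᵥ b) j * (hessOf uCoord *ᵥ c) k *
      vecDer w (dLamDer i (covar j k)) =
        jetFun uCoord (linForm (crossVec w a) * linForm b * linForm c) +
        jetFun uCoord (linForm a * linForm (crossVec w b) * linForm c) +
        jetFun uCoord (linForm a * linForm b * linForm (crossVec w c)) -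
        jetFun uCoord (linForm w * linForm a * linForm b * linForm c) := by
  have h := vecDer_jetFun_three w a b c
  rw [← neg_eq_iff_eq_neg.2 (sum_dLamDer_covar a b c)] at h
  simp only [map_neg, map_sum, Derivation.leibniz, smul_eq_mul, vecDer_hessOf_mulVec] at h
  have e : ∀ i j k : Fin n, (hessOf uCoord *ᵥ a) i * (hessOf uCoord *ᵥ b) j *
        (hessOf uCoord *ᵥ c) k * vecDer w (dLamDer i (covar j k)) +
      dLamDer i (covar j k) * ((hessOf uCoord *ᵥ a) i * (hessOf uCoord *ᵥ b) j *
        (hessOf uCoord *ᵥ (vecDer w ∘ c + crossVec w c)) k + (hessOf uCoord *ᵥ c) k *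
        ((hessOf uCoord *ᵥ a) i * (hessOf uCoord *ᵥ (vecDer w ∘ b + crossVec w b)) j +
        (hessOf uCoord *ᵥ b) j * (hessOf uCoord *ᵥ (vecDer w ∘ a + crossVec w a)) i)) =
      (hessOf uCoord *ᵥ a) i * (hessOf uCoord *ᵥ b) j *
        (hessOf uCoord *ᵥ c) k * vecDer w (dLamDer i (covar j k)) +
      (hessOf uCoord *ᵥ a) i * (hessOf uCoord *ᵥ b) j *
        (hessOf uCoord *ᵥ (vecDer w ∘ c + crossVec w c)) k * dLamDer i (covar j k) +
      (hessOf uCoord *ᵥ a) i * (hessOf uCoord *ᵥ (vecDer w ∘ b + crossVec w b)) j *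
        (hessOf uCoord *ᵥ c) k * dLamDer i (covar j k) +
      (hessOf uCoord *ᵥ (vecDer w ∘ a + crossVec w a)) i * (hessOf uCoord *ᵥ b) j *
        (hessOf uCoord *ᵥ c) k * dLamDer i (covar j k) := by
    intro i j k; ring
  simp only [e, Finset.sum_add_distrib, sum_dLamDer_covar] at h
  simp only [map_add, add_mul, mul_add] at h
  linear_combination -h

theorem sum_fin_succ_fun {α M : Type*} [Fintype α] [AddCommMonoid M] {k : ℕ}
    (F : (Fin (k + 1) → α) → M) : ∑ τ, F τ = ∑ i, ∑ τ : Fin k → α, F (Matrix.vecCons i τ) := by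
  rw [← (Fin.consEquiv fun _ => α).sum_comp, Fintype.sum_prod_type]
  rfl

theorem sigma_two (w : Fin 2 → Fin n → DiffFun n) :
    sigma 2 w = jetFun uCoord (linForm (w 0) * linForm (w 1)) := by
  simp only [sigma, sum_fin_succ_fun, Finset.univ_unique, Finset.sum_singleton, centralMoment_two, vecAct_lam,
    Fin.prod_univ_two]
  rw [← sum_covar]
  refine Finset.sum_congr rfl fun i _ => Finset.sum_congr rfl fun j _ => ?_
  exact mul_comm _ _

theorem sigma_three (w : Fin 3 → Fin n → DiffFun n) :
    sigma 3 w = -jetFun uCoord (linForm (w 0) * linForm (w 1) * linForm (w 2)) := by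
  simp only [sigma, sum_fin_succ_fun, Finset.univ_unique, Finset.sum_singleton, centralMoment_three, vecAct_lam,
    Fin.prod_univ_three]
  rw [← sum_dLamDer_covar]
  refine Finset.sum_congr rfl fun i _ => Finset.sum_congr rfl fun j _ =>
    Finset.sum_congr rfl fun k _ => ?_
  exact mul_comm _ _

theorem sum_mul_sum_four {ι R : Type*} [Fintype ι] [CommRing R] (F G : ι → ι → R) :
    ∑ i, ∑ j, ∑ k, ∑ l, F i j * G k l = (∑ i, ∑ j, F i j) * ∑ k, ∑ l, G k l := by
  simp only [Finset.sum_mul]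
  simp only [Finset.mul_sum]

/-- The fourth cumulant contributes -u_4 and the corrections, the pairings contribute products of
u_2. Thus σ_4 and -u_4 agree up to terms of order at most three. -/
theorem sigma_four (w : Fin 4 → Fin n → DiffFun n) :
    sigma 4 w = jetFun uCoord (linForm (crossVec (w 0) (w 1)) * linForm (w 2) * linForm (w 3)) +
        jetFun uCoord (linForm (w 1) * linForm (crossVec (w 0) (w 2)) * linForm (w 3)) +
        jetFun uCoord (linForm (w 1) * linForm (w 2) * linForm (crossVec (w 0) (w 3))) -
        jetFun uCoord (linForm (w 0) * linForm (w 1) * linForm (w 2) * linForm (w 3)) +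
      jetFun uCoord (linForm (w 0) * linForm (w 1)) * jetFun uCoord (linForm (w 2) * linForm (w 3)) +
      jetFun uCoord (linForm (w 0) * linForm (w 2)) * jetFun uCoord (linForm (w 1) * linForm (w 3)) +
      jetFun uCoord (linForm (w 0) * linForm (w 3)) *
        jetFun uCoord (linForm (w 1) * linForm (w 2)) := by
  simp only [sigma, sum_fin_succ_fun, Finset.univ_unique, Finset.sum_singleton, centralMoment_four, vecAct_lam,
    Fin.prod_univ_four]
  simp only [Matrix.cons_val, add_mul, Finset.sum_add_distrib]
  generalize w 0 = a
  generalize w 1 = b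
  generalize w 2 = c
  generalize w 3 = d
  congr 1; congr 1; congr 1
  · rw [← sum_vecDer_dLamDer_covar]
    simp only [← sum_hessOf_mul_dLamDer a, Finset.mul_sum]
    rw [Finset.sum_comm]
    refine Finset.sum_congr rfl fun j _ => ?_
    rw [Finset.sum_comm]
    refine Finset.sum_congr rfl fun k _ => ?_
    rw [Finset.sum_comm]
    refine Finset.sum_congr rfl fun l _ => Finset.sum_congr rfl fun i _ => ?_
    ring
  · rw [← sum_covar, ← sum_covar, ← sum_mul_sum_four]
    refine Finset.sum_congr rfl fun i _ => Finset.sum_congr rfl fun j _ =>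
      Finset.sum_congr rfl fun k _ => Finset.sum_congr rfl fun l _ => ?_
    ring
  · rw [← sum_covar, ← sum_covar, ← sum_mul_sum_four]
    refine Finset.sum_congr rfl fun i _ => ?_
    rw [Finset.sum_comm]
    refine Finset.sum_congr rfl fun j _ =>
      Finset.sum_congr rfl fun k _ => Finset.sum_congr rfl fun l _ => ?_
    ring
  · rw [← sum_covar, ← sum_covar, ← sum_mul_sum_four]
    refine Finset.sum_congr rfl fun i _ => ?_
    rw [Finset.sum_congr rfl fun j _ => Finset.sum_comm, Finset.sum_comm]
    refine Finset.sum_congr rfl fun j _ =>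
      Finset.sum_congr rfl fun k _ => Finset.sum_congr rfl fun l _ => ?_
    ring

theorem coordVec_eq (i : Fin n) : linForm (coordVec i : Fin n → DiffFun n) = X i :=
  linForm_single i

theorem sigmaTwoMatrix_eq (n : ℕ) : sigmaTwoMatrix n = hessOf uCoord := by
  ext i j
  simp [sigmaTwoMatrix, sigma_two, coordVec_eq, hessOf]

theorem vOne_eq (n : ℕ) : vOne n = vOneOf uCoord := by
  rw [vOne, vOneOf, sigmaTwoMatrix_eq, lam_eq_lamOf]

theorem endoA_eq (n : ℕ) : endoA n = endoOf uCoord := by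
  rw [endoA, endoOf, sigmaTwoMatrix_eq]
  congr 2
  funext i j
  simp [sigma_three, coordVec_eq, vOne_eq]

theorem frame_eq (i : Fin n) : frame i = (frameOf uCoord).col i := by
  rw [frame, endoA_eq, vOne_eq, frameOf_col]

/-! ### Components of the symmetric forms in the frame -/

/-- The frame vector with index `i`. -/
abbrev fvec (i : Fin n) : Fin n → DiffFun n := (frameOf uCoord).col i

theorem fvec_zero [NeZero n] : fvec (0 : Fin n) = vOneOf uCoord := by
  simp [fvec, frameOf_col]

theorem fvec_succ {j : ℕ} (hj : j + 1 < n) :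
    fvec (⟨j + 1, hj⟩ : Fin n) = endoOf uCoord *ᵥ fvec ⟨j, (Nat.lt_succ_self j).trans hj⟩ := by
  simp only [fvec, frameOf_col]
  rw [pow_succ', ← Matrix.mulVec_mulVec]

/-- The polynomials of degree `k` in the frame with coefficients in `B`. -/
def framePoly (B : Subalgebra ℝ (DiffFun n)) (k : ℕ) :
    Submodule B (MvPolynomial (Fin n) (DiffFun n)) :=
  Submodule.span B (Set.range fun i => linForm (fvec i)) ^ k

theorem subalgebra_smul_eq (B : Subalgebra ℝ (DiffFun n)) (b : B)
    (p : MvPolynomial (Fin n) (DiffFun n)) : b • p = C (b : DiffFun n) * p := by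
  rw [← smul_eq_C_mul]; rfl

theorem mul_mem_framePoly {B : Subalgebra ℝ (DiffFun n)} {k l : ℕ}
    {p q : MvPolynomial (Fin n) (DiffFun n)} (hp : p ∈ framePoly B k) (hq : q ∈ framePoly B l) :
    p * q ∈ framePoly B (k + l) := by
  rw [framePoly, pow_add]
  exact Submodule.mul_mem_mul hp hq

theorem fvec_mem_framePoly (B : Subalgebra ℝ (DiffFun n)) (i : Fin n) :
    linForm (fvec i) ∈ framePoly B 1 := by
  rw [framePoly, pow_one]
  exact Submodule.subset_span ⟨i, rfl⟩

theorem colProd_mem_framePoly (B : Subalgebra ℝ (DiffFun n)) (s : Multiset (Fin n)) :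
    colProd (frameOf uCoord) s ∈ framePoly B s.card := by
  induction s using Multiset.induction_on with
  | empty =>
    rw [colProd, Multiset.map_zero, Multiset.prod_zero, Multiset.card_zero, framePoly, pow_zero]
    exact Submodule.one_le.1 le_rfl
  | cons i s ih =>
    rw [colProd, Multiset.map_cons, Multiset.prod_cons, Multiset.card_cons, add_comm]
    exact mul_mem_framePoly (fvec_mem_framePoly B i) ih

/-- A property of the products of `k` frame forms that is linear holds on `framePoly`. -/
theorem jetFun_mem_of_framePoly {B : Subalgebra ℝ (DiffFun n)} {k : ℕ}
    (h : ∀ τ : Fin k → Fin n, jetFun uCoord (List.ofFn fun a => linForm (fvec (τ a))).prod ∈ B)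
    {p : MvPolynomial (Fin n) (DiffFun n)} (hp : p ∈ framePoly B k) : jetFun uCoord p ∈ B := by
  rw [framePoly, Submodule.span_pow] at hp
  induction hp using Submodule.span_induction with
  | mem x hx =>
    obtain ⟨f, rfl⟩ := Set.mem_pow.1 hx
    choose τ hτ using fun a => (f a).2
    simp only [← hτ]
    exact h τ
  | zero => rw [map_zero]; exact B.zero_mem
  | add x y _ _ hx hy => rw [map_add]; exact B.add_mem hx hy
  | smul b x _ hx =>
    rw [subalgebra_smul_eq, jetFun_C_mul]
    exact B.mul_mem b.2 hx

theorem constantCoeff_of_framePoly {B : Subalgebra ℝ (DiffFun n)} {k : ℕ}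
    {p : MvPolynomial (Fin n) (DiffFun n)} (hp : p ∈ framePoly B (k + 1)) :
    constantCoeff p = 0 := by
  rw [framePoly, pow_succ'] at hp
  induction hp using Submodule.mul_induction_on' with
  | mem_mul_mem m hm q _ =>
    have h : constantCoeff m = 0 := by
      induction hm using Submodule.span_induction with
      | mem x hx => obtain ⟨i, rfl⟩ := hx; exact constantCoeff_linForm _
      | zero => rw [map_zero]
      | add x y _ _ hx hy => rw [map_add, hx, hy, add_zero]
      | smul b x _ hx => rw [subalgebra_smul_eq, map_mul, hx, mul_zero]
    rw [map_mul, h, zero_mul]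
  | add x _ y _ hx hy => rw [map_add, hx, hy, add_zero]

theorem sigmaFrame_three (i j k : Fin n) : sigmaFrame ![i, j, k] =
    -jetFun uCoord (linForm (fvec i) * linForm (fvec j) * linForm (fvec k)) := by
  rw [sigmaFrame, sigma_three]
  simp only [frame_eq]
  rfl

/-- The Gram matrix of the frame. -/
def gram (n : ℕ) : Matrix (Fin n) (Fin n) (DiffFun n) := hessOf (substJet uCoord (frameOf uCoord))

theorem gram_apply (i j : Fin n) :
    gram n i j = jetFun uCoord (linForm (fvec i) * linForm (fvec j)) := by
  change jetFun _ (X i * X j) = _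
  rw [jetFun_substJet, map_mul, aeval_X, aeval_X]

theorem isUnit_det_gram (n : ℕ) : IsUnit (gram n).det :=
  isUnit_det_hessOf_substJet isUnit_det_hessOf_uCoord isUnit_det_frameOf_uCoord

theorem matrix_det_mem {A : Subalgebra ℝ (DiffFun n)} {M : Matrix (Fin n) (Fin n) (DiffFun n)}
    (hM : ∀ i j, M i j ∈ A) : M.det ∈ A := by
  let M' : Matrix (Fin n) (Fin n) A := Matrix.of fun i j => ⟨M i j, hM i j⟩
  have h : (A.val : A →+* DiffFun n).mapMatrix M' = M := rfl
  rw [← h, ← RingHom.map_det]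
  exact M'.det.2

/-- Cramer's rule: the determinant is the only element that has to be inverted. -/
theorem matrix_inv_mem {A : Subalgebra ℝ (DiffFun n)} (hA : InvClosed A)
    {M : Matrix (Fin n) (Fin n) (DiffFun n)} (hM : ∀ i j, M i j ∈ A) (hdet : IsUnit M.det)
    (i j : Fin n) : M⁻¹ i j ∈ A := by
  let M' : Matrix (Fin n) (Fin n) A := Matrix.of fun i j => ⟨M i j, hM i j⟩
  have h : (A.val : A →+* DiffFun n).mapMatrix M' = M := rfl
  have hadj : M.adjugate i j ∈ A := by
    rw [← h, ← RingHom.map_adjugate]; exact (M'.adjugate i j).2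
  rw [Matrix.inv_def, Matrix.smul_apply, smul_eq_mul]
  exact A.mul_mem (hA _ (matrix_det_mem hM) _ (Ring.mul_inverse_cancel _ hdet)) hadj

/-! ### Frame components of order at most three -/

section orderThree

variable [NeZero n] {B : Subalgebra ℝ (DiffFun n)}

theorem jetFun_fvec_three_mem (hB : gensThree n ⊆ B) (i j k : Fin n) :
    jetFun uCoord (linForm (fvec i) * linForm (fvec j) * linForm (fvec k)) ∈ B := by
  have h : sigmaFrame ![i, j, k] ∈ B := hB (Or.inr ⟨_, rfl⟩)
  rw [sigmaFrame_three] at h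
  simpa using B.neg_mem h

/-- By v_{i+1} = A v_i, u_2(v_{i+1}, v_j) = -u_3(v_1, v_i, v_j). By symmetry only u_2(v_1, v_1) is
not of this form. -/
theorem jetFun_fvec_two_mem (hB : gensThree n ⊆ B) (i j : Fin n) :
    jetFun uCoord (linForm (fvec i) * linForm (fvec j)) ∈ B := by
  have key : ∀ (a : ℕ) (ha : a + 1 < n) (j : Fin n),
      jetFun uCoord (linForm (fvec ⟨a + 1, ha⟩) * linForm (fvec j)) ∈ B := by
    intro a ha j
    rw [fvec_succ, jetFun_endoOf_mul isUnit_det_hessOf_uCoord, ← fvec_zero]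
    exact B.neg_mem (jetFun_fvec_three_mem hB _ _ _)
  obtain ⟨i, hi⟩ := i
  obtain ⟨j, hj⟩ := j
  cases i with
  | succ a => exact key a hi _
  | zero =>
    cases j with
    | succ b => rw [mul_comm]; exact key b hj _
    | zero =>
      have h : sigmaFrame ![(0 : Fin n), 0] ∈ B := hB (Or.inl rfl)
      rw [sigmaFrame, sigma_two] at h
      simp only [frame_eq] at h
      exact h

/-- The equation defining v_1 gives u_1(v_i) = u_2(v_1, v_i). -/
theorem jetFun_fvec_one_mem (hB : gensThree n ⊆ B) (i : Fin n) :
    jetFun uCoord (linForm (fvec i)) ∈ B := by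
  rw [← jetFun_vOneOf_mul isUnit_det_hessOf_uCoord, ← fvec_zero]
  exact jetFun_fvec_two_mem hB _ _

theorem jetFun_mem_of_framePoly_le_three (hB : gensThree n ⊆ B) {k : ℕ} (hk : k ≤ 3)
    {p : MvPolynomial (Fin n) (DiffFun n)} (hp : p ∈ framePoly B k) : jetFun uCoord p ∈ B := by
  refine jetFun_mem_of_framePoly (fun τ => ?_) hp
  interval_cases k
  · simp only [List.ofFn_zero, List.prod_nil, jetFun_one]; exact B.zero_mem
  · simpa using jetFun_fvec_one_mem hB (τ 0)
  · simpa using jetFun_fvec_two_mem hB (τ 0) (τ 1)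
  · simpa [← mul_assoc] using jetFun_fvec_three_mem hB (τ 0) (τ 1) (τ 2)

theorem gram_inv_mem (hB : gensThree n ⊆ B) (hI : InvClosed B) (i j : Fin n) :
    (gram n)⁻¹ i j ∈ B := by
  refine matrix_inv_mem hI (fun i j => ?_) (isUnit_det_gram n) i j
  rw [gram_apply]
  exact jetFun_fvec_two_mem hB i j

/-- A vector whose products with the frame lie in an algebra has components in it. -/
theorem linForm_mem_framePoly {B' : Subalgebra ℝ (DiffFun n)} (hB : gensThree n ⊆ B)
    (hI : InvClosed B) (hle : B ≤ B') {w : Fin n → DiffFun n}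
    (h : ∀ m, jetFun uCoord (linForm w * linForm (fvec m)) ∈ B') :
    linForm w ∈ framePoly B' 1 := by
  let d : Fin n → DiffFun n := fun m => jetFun uCoord (linForm w * linForm (fvec m))
  -- The components solve a linear system whose matrix is the Gram matrix. Its inverse has entries
  -- in `B`, so `B'` need not be closed under inverses.
  let c : Fin n → DiffFun n := (gram n)⁻¹ *ᵥ d
  have hc : ∀ k, c k ∈ B' := by
    intro k
    change ∑ m, (gram n)⁻¹ k m * d m ∈ B'
    exact B'.sum_mem fun m _ => B'.mul_mem (hle (gram_inv_mem hB hI k m)) (h m)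
  have hw : linForm w = ∑ k, C (c k) * linForm (fvec k) := by
    have e : ∑ k, C (c k) * linForm (fvec k) = linForm (∑ k, c k • fvec k) := by
      simp [smul_eq_C_mul]
    rw [e]
    congr 1
    refine hessOf_ext_col isUnit_det_hessOf_uCoord isUnit_det_frameOf_uCoord fun i => ?_
    rw [← e, Finset.sum_mul, map_sum]
    have h2 : gram n *ᵥ c = d := by
      rw [Matrix.mulVec_mulVec, Matrix.mul_nonsing_inv _ (isUnit_det_gram n), Matrix.one_mulVec]
    change d i = _
    rw [← h2]
    change ∑ k, gram n i k * c k = _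
    refine Finset.sum_congr rfl fun k _ => ?_
    rw [mul_assoc, jetFun_C_mul, gram_apply, mul_comm (c k), mul_comm (linForm _)]
  rw [hw]
  refine Submodule.sum_mem _ fun k _ => ?_
  have := (framePoly B' 1).smul_mem (⟨c k, hc k⟩ : B') (fvec_mem_framePoly B' k)
  rwa [subalgebra_smul_eq] at this

end orderThree

theorem vecDer_jetFun_one (w a : Fin n → DiffFun n) :
    vecDer w (jetFun uCoord (linForm a)) =
      jetFun uCoord (linForm (vecDer w ∘ a)) + jetFun uCoord (linForm w * linForm a) := by
  rw [vecDer_jetFun w (constantCoeff_linForm _), coeffDeriv_linForm]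

theorem vecDer_fvec_mem {B' : Subalgebra ℝ (DiffFun n)} (hD : FrameClosed B') {f : DiffFun n} (hf : f ∈ B') (i : Fin n) :
    vecDer (fvec i) f ∈ B' := by
  have h := hD f hf i
  rwa [frameD, frame_eq, ← vecDer_apply] at h

/-- Leibniz: coefficients stay in `B'` because it is closed under the v_i, and frame vectors are
handled by `hv`. -/
theorem coeffDeriv_mem_framePoly {B' : Subalgebra ℝ (DiffFun n)} (hD : FrameClosed B')
    (hv : ∀ i j : Fin n, linForm (vecDer (fvec i) ∘ fvec j) ∈ framePoly B' 1) (i : Fin n) {k : ℕ}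
    {p : MvPolynomial (Fin n) (DiffFun n)} (hp : p ∈ framePoly B' k) :
    coeffDeriv (vecDer (fvec i)) p ∈ framePoly B' k := by
  induction k generalizing p with
  | zero =>
    rw [framePoly, pow_zero, Submodule.mem_one] at hp ⊢
    obtain ⟨b, rfl⟩ := hp
    exact ⟨⟨_, vecDer_fvec_mem hD b.2 i⟩, (coeffDeriv_C _ _).symm⟩
  | succ k ih =>
    have hp' := hp
    rw [framePoly, pow_succ'] at hp'
    clear hp
    induction hp' using Submodule.mul_induction_on' with
    | mem_mul_mem m hm q hq =>
      have h1 : m ∈ framePoly B' 1 := by rwa [framePoly, pow_one]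
      have h : coeffDeriv (vecDer (fvec i)) m ∈ framePoly B' 1 := by
        clear h1
        induction hm using Submodule.span_induction with
        | mem x hx =>
          obtain ⟨j, rfl⟩ := hx
          rw [coeffDeriv_linForm]
          exact hv i j
        | zero => rw [map_zero]; exact Submodule.zero_mem _
        | add x y _ _ hx hy => rw [map_add]; exact Submodule.add_mem _ hx hy
        | smul b x hx' hx =>
          have h1 : x ∈ framePoly B' 1 := by rwa [framePoly, pow_one]
          rw [subalgebra_smul_eq, Derivation.leibniz, smul_eq_mul, smul_eq_mul, coeffDeriv_C,
            mul_comm x]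
          refine Submodule.add_mem _ ?_ ?_
          · have := (framePoly B' 1).smul_mem b hx
            rwa [subalgebra_smul_eq] at this
          · have := (framePoly B' 1).smul_mem (⟨_, vecDer_fvec_mem hD b.2 i⟩ : B') h1
            rwa [subalgebra_smul_eq] at this
      rw [Derivation.leibniz, smul_eq_mul, smul_eq_mul, mul_comm q, add_comm k 1]
      exact Submodule.add_mem _ (mul_mem_framePoly h1 (ih hq)) (mul_mem_framePoly h hq)
    | add x _ y _ hx hy => rw [map_add]; exact Submodule.add_mem _ hx hy

/-! ### Frame components of order four and above -/

section higherOrder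

variable [NeZero n] {B B' : Subalgebra ℝ (DiffFun n)}

theorem crossVec_mem_framePoly (hB : gensThree n ⊆ B) (hI : InvClosed B) (hle : B ≤ B')
    (i j : Fin n) : linForm (crossVec (fvec i) (fvec j)) ∈ framePoly B' 1 := by
  refine linForm_mem_framePoly hB hI hle fun m => ?_
  rw [jetFun_crossVec_mul]
  exact hle (jetFun_fvec_three_mem hB i j m)

/-- Solve `sigma_four` for u_4; every other term has order at most three and components in `B'`. -/
theorem jetFun_fvec_four_mem (hB : gensThree n ⊆ B) (hI : InvClosed B) (hle : B ≤ B')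
    (h4 : gensFour n ⊆ B') (i j k l : Fin n) :
    jetFun uCoord (linForm (fvec i) * linForm (fvec j) * linForm (fvec k) * linForm (fvec l)) ∈
      B' := by
  have hB' : gensThree n ⊆ B' := hB.trans hle
  have h : sigmaFrame ![i, j, k, l] ∈ B' := h4 ⟨_, rfl⟩
  rw [sigmaFrame, sigma_four] at h
  simp only [frame_eq, Matrix.cons_val] at h
  have hv := fvec_mem_framePoly B'
  have hc := crossVec_mem_framePoly hB hI hle
  have c1 := jetFun_mem_of_framePoly_le_three hB' le_rfl
    (mul_mem_framePoly (mul_mem_framePoly (hc i j) (hv k)) (hv l))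
  have c2 := jetFun_mem_of_framePoly_le_three hB' le_rfl
    (mul_mem_framePoly (mul_mem_framePoly (hv j) (hc i k)) (hv l))
  have c3 := jetFun_mem_of_framePoly_le_three hB' le_rfl
    (mul_mem_framePoly (mul_mem_framePoly (hv j) (hv k)) (hc i l))
  have h2 := jetFun_fvec_two_mem hB'
  have := B'.sub_mem (B'.add_mem (B'.add_mem (B'.add_mem (B'.add_mem (B'.add_mem c1 c2) c3)
    (B'.mul_mem (h2 i j) (h2 k l))) (B'.mul_mem (h2 i k) (h2 j l)))
    (B'.mul_mem (h2 i l) (h2 j k))) h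
  convert this using 1
  ring

/-- The frame derivatives of the frame have components in `B'`. -/
theorem vecDer_fvec_mem_framePoly (hB : gensThree n ⊆ B) (hI : InvClosed B) (hle : B ≤ B')
    (h4 : gensFour n ⊆ B') (i j : Fin n) :
    linForm (vecDer (fvec i) ∘ fvec j) ∈ framePoly B' 1 := by
  have hU := isUnit_det_hessOf_uCoord (n := n)
  have hB' : gensThree n ⊆ B' := hB.trans hle
  have hv := fvec_mem_framePoly B'
  have base : linForm (vecDer (fvec i) ∘ fvec 0) ∈ framePoly B' 1 := by
    refine linForm_mem_framePoly hB hI hle fun m => ?_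
    -- Differentiate u_2(v_1, v_m) = u_1(v_m) along v_i. The terms with the derivative of v_m
    -- cancel, since the same equation holds for every vector in place of v_m. Here `fvec 0` is v_1.
    have e := congrArg (vecDer (fvec i)) (jetFun_vOneOf_mul hU (fvec m))
    rw [← fvec_zero, vecDer_jetFun_two, vecDer_jetFun_one, fvec_zero, jetFun_vOneOf_mul hU,
      ← fvec_zero] at e
    have : jetFun uCoord (linForm (vecDer (fvec i) ∘ fvec 0) * linForm (fvec m)) =
        jetFun uCoord (linForm (fvec i) * linForm (fvec m)) -
        jetFun uCoord (linForm (fvec i) * linForm (fvec 0) * linForm (fvec m)) := by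
      linear_combination e
    rw [this]
    exact B'.sub_mem (jetFun_fvec_two_mem hB' _ _) (jetFun_fvec_three_mem hB' _ _ _)
  obtain ⟨j, hj⟩ := j
  induction j with
  | zero => exact base
  | succ j ih =>
    have ih' := ih ((Nat.lt_succ_self j).trans hj)
    set v : Fin n → DiffFun n := fvec ⟨j, (Nat.lt_succ_self j).trans hj⟩
    refine linForm_mem_framePoly hB hI hle fun m => ?_
    -- Differentiate u_2(A v, v_m) = -u_3(v_1, v, v_m) along v_i. The derivative of v_m cancels
    -- again, and the one term in u_4 is where the generators σ_4 enter.
    have e := congrArg (vecDer (fvec i)) (jetFun_endoOf_mul hU v (fvec m))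
    rw [← fvec_succ hj, ← fvec_zero, map_neg, vecDer_jetFun_two, vecDer_jetFun_three, fvec_succ hj,
      jetFun_endoOf_mul hU v (vecDer (fvec i) ∘ fvec m), ← fvec_succ hj, ← fvec_zero] at e
    have : jetFun uCoord (linForm (vecDer (fvec i) ∘ fvec ⟨j + 1, hj⟩) * linForm (fvec m)) =
        -jetFun uCoord (linForm (fvec i) * linForm (fvec ⟨j + 1, hj⟩) * linForm (fvec m)) -
        jetFun uCoord (linForm (vecDer (fvec i) ∘ fvec 0) * linForm v * linForm (fvec m)) -
        jetFun uCoord (linForm (fvec 0) * linForm (vecDer (fvec i) ∘ v) * linForm (fvec m)) -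
        jetFun uCoord (linForm (fvec i) * linForm (fvec 0) * linForm v * linForm (fvec m)) := by
      linear_combination e
    rw [this]
    refine B'.sub_mem (B'.sub_mem (B'.sub_mem (B'.neg_mem (jetFun_fvec_three_mem hB' _ _ _)) ?_) ?_)
      (jetFun_fvec_four_mem hB hI hle h4 _ _ _ _)
    · exact jetFun_mem_of_framePoly_le_three hB' le_rfl
        (mul_mem_framePoly (mul_mem_framePoly base (hv _)) (hv _))
    · exact jetFun_mem_of_framePoly_le_three hB' le_rfl
        (mul_mem_framePoly (mul_mem_framePoly (hv _) ih') (hv _))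

/-- Induction on the order by u_{k+1}(v_i, q) = v_i(u_k(q)) - u_k(∇_{v_i} q), where ∇ keeps `q`
homogeneous of degree k in the frame with coefficients in `B'`. -/
theorem jetFun_mem_of_framePoly_of_frameClosed (hB : gensThree n ⊆ B) (hI : InvClosed B)
    (hle : B ≤ B') (h4 : gensFour n ⊆ B') (hD : FrameClosed B') {k : ℕ}
    {p : MvPolynomial (Fin n) (DiffFun n)} (hp : p ∈ framePoly B' k) : jetFun uCoord p ∈ B' := by
  have hv := vecDer_fvec_mem_framePoly hB hI hle h4
  induction k generalizing p with
  | zero => exact jetFun_mem_of_framePoly_le_three (hB.trans hle) (Nat.zero_le 3) hp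
  | succ k ih =>
    -- Degree one is separate: the recursion requires the remaining factor to have no constant term.
    rcases k with - | k
    · exact jetFun_mem_of_framePoly_le_three (hB.trans hle) (by norm_num) hp
    rw [framePoly, pow_succ'] at hp
    induction hp using Submodule.mul_induction_on' with
    | mem_mul_mem m hm q hq =>
      induction hm using Submodule.span_induction with
      | mem x hx =>
        obtain ⟨i, rfl⟩ := hx
        have e := vecDer_jetFun (fvec i) (constantCoeff_of_framePoly hq)
        rw [← sub_eq_iff_eq_add'] at e
        change jetFun uCoord (linForm (fvec i) * q) ∈ B'
        rw [← e]
        exact B'.sub_mem (vecDer_fvec_mem hD (ih hq) i) (ih (coeffDeriv_mem_framePoly hD hv i hq))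
      | zero => rw [zero_mul, map_zero]; exact B'.zero_mem
      | add x y _ _ hx hy => rw [add_mul, map_add]; exact B'.add_mem hx hy
      | smul b x _ hx =>
        rw [subalgebra_smul_eq, mul_assoc, jetFun_C_mul]
        exact B'.mul_mem b.2 hx
    | add x _ y _ hx hy => rw [map_add]; exact B'.add_mem hx hy

end higherOrder

/-! ### Invariance of the generators -/

theorem frameD_eq (i : Fin n) (f : DiffFun n) : frameD i f = vecAct (fvec i) f := by
  rw [frameD, frame_eq]

theorem pull_frameD (g : Aff n) (i : Fin n) (f : DiffFun n) :
    pull g (frameD i f) = frameD i (pull g f) := by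
  rw [frameD_eq, frameD_eq, pull_vecAct, linInvD_mulVec_frameOf]

/-- The algebra of differential invariants. -/
def invariants (n : ℕ) : Subalgebra ℝ (DiffFun n) where
  carrier := {f | ∀ g, pull g f = f}
  mul_mem' hf hf' g := by rw [map_mul, hf g, hf' g]
  add_mem' hf hf' g := by rw [map_add, hf g, hf' g]
  algebraMap_mem' c g := pull_algebraMap_real g c

theorem mem_invariants {f : DiffFun n} : f ∈ invariants n ↔ IsDiffInvariant f :=
  isDiffInvariant_iff.symm

theorem invClosed_invariants : InvClosed (invariants n) := by
  intro f hf h e g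
  have h1 : f * pull g h = 1 := by
    have := congrArg (pull g) e
    rwa [map_mul, hf g, map_one] at this
  calc pull g h = pull g h * (f * h) := by rw [e, mul_one]
    _ = (f * pull g h) * h := by ring
    _ = h := by rw [h1, one_mul]

theorem frameClosed_invariants : FrameClosed (invariants n) := by
  intro f hf i g
  rw [pull_frameD, hf g]

/-- An invariant vector field. -/
def IsInvariantVec (w : Fin n → DiffFun n) : Prop := ∀ g, linInvD g *ᵥ (pull g ∘ w) = w

theorem isInvariantVec_fvec (i : Fin n) : IsInvariantVec (fvec i) :=
  fun g => linInvD_mulVec_frameOf g i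

theorem jetFun_two_mem_invariants {a b : Fin n → DiffFun n} (ha : IsInvariantVec a)
    (hb : IsInvariantVec b) : jetFun uCoord (linForm a * linForm b) ∈ invariants n := by
  intro g
  simp only [pull_jetFun, map_mul, map_linForm, aeval_linForm, ha g, hb g]

theorem jetFun_three_mem_invariants {a b c : Fin n → DiffFun n} (ha : IsInvariantVec a)
    (hb : IsInvariantVec b) (hc : IsInvariantVec c) :
    jetFun uCoord (linForm a * linForm b * linForm c) ∈ invariants n := by
  intro g
  simp only [pull_jetFun, map_mul, map_linForm, aeval_linForm, ha g, hb g, hc g]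

theorem jetFun_four_mem_invariants {a b c d : Fin n → DiffFun n} (ha : IsInvariantVec a)
    (hb : IsInvariantVec b) (hc : IsInvariantVec c) (hd : IsInvariantVec d) :
    jetFun uCoord (linForm a * linForm b * linForm c * linForm d) ∈ invariants n := by
  intro g
  simp only [pull_jetFun, map_mul, map_linForm, aeval_linForm, ha g, hb g, hc g, hd g]

/-- The vector is characterised by u_2(c, ·) = u_3(a, b, ·), and pulling back this equation
preserves it. -/
theorem IsInvariantVec.crossVec {a b : Fin n → DiffFun n} (ha : IsInvariantVec a)
    (hb : IsInvariantVec b) : IsInvariantVec (crossVec a b) := by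
  intro g
  refine hessOf_ext_col isUnit_det_hessOf_uCoord (isUnit_det_linInvD g) fun i => ?_
  have h : jetFun uCoord (linForm (AffInv.crossVec a b) * X i) =
      jetFun uCoord (linForm a * linForm b * X i) := by
    simpa using jetFun_crossVec_mul a b (Pi.single i 1)
  have h2 := congrArg (pull g) h
  simp only [pull_jetFun, map_mul, map_linForm, aeval_linForm, ha g, hb g, map_X, aeval_X] at h2
  rw [h2, jetFun_crossVec_mul]

theorem gensThree_subset_invariants [NeZero n] : gensThree n ⊆ invariants n := by
  have hv := isInvariantVec_fvec (n := n)
  rintro f (rfl | ⟨τ, rfl⟩)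
  · rw [sigmaFrame, sigma_two]
    simp only [frame_eq]
    exact jetFun_two_mem_invariants (hv _) (hv _)
  · rw [sigmaFrame, sigma_three]
    simp only [frame_eq]
    exact (invariants n).neg_mem (jetFun_three_mem_invariants (hv _) (hv _) (hv _))

theorem gensFour_subset_invariants : gensFour n ⊆ invariants n := by
  have hv := isInvariantVec_fvec (n := n)
  rintro f ⟨τ, rfl⟩
  rw [sigmaFrame, sigma_four]
  simp only [frame_eq]
  have hc := fun i j : Fin n => (hv i).crossVec (hv j)
  have h2 := fun i j : Fin n => jetFun_two_mem_invariants (hv i) (hv j)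
  exact add_mem (add_mem (add_mem (sub_mem (add_mem (add_mem
    (jetFun_three_mem_invariants (hc _ _) (hv _) (hv _))
    (jetFun_three_mem_invariants (hv _) (hc _ _) (hv _)))
    (jetFun_three_mem_invariants (hv _) (hv _) (hc _ _)))
    (jetFun_four_mem_invariants (hv _) (hv _) (hv _) (hv _)))
    (mul_mem (h2 _ _) (h2 _ _))) (mul_mem (h2 _ _) (h2 _ _))) (mul_mem (h2 _ _) (h2 _ _))

/-! ### Orders of denominators -/

/-- The values of the symmetric forms lie in any algebra that contains the coordinates of bounded
order and the components of the vectors. -/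
theorem jetFun_prod_mem {R : Type*} [CommRing R] [Algebra ℝ R] {A : Subalgebra ℝ R}
    {U : FibreIdx n → R} {k : ℕ} (hU : ∀ s : FibreIdx n, s.1.card ≤ k → U s ∈ A)
    (W : Multiset (Fin n → R)) (hW : ∀ w ∈ W, ∀ i, w i ∈ A) (m : Multiset (Fin n))
    (hk : W.card + m.card ≤ k) : jetFun U ((W.map linForm).prod * (m.map X).prod) ∈ A := by
  induction W using Multiset.induction_on generalizing m with
  | empty =>
    rw [Multiset.map_zero, Multiset.prod_zero, one_mul]
    by_cases hm : m = 0
    · rw [hm, Multiset.map_zero, Multiset.prod_zero, jetFun_one]; exact A.zero_mem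
    · rw [jetFun_prod_X U ⟨m, hm⟩]
      exact hU _ (by simpa using hk)
  | cons w W ih =>
    rw [Multiset.map_cons, Multiset.prod_cons, mul_right_comm, mul_assoc, mul_comm,
      jetFun_mul_linForm]
    refine A.sum_mem fun i _ => A.mul_mem (hW w (by simp) i) ?_
    have h := ih (fun w' hw' => hW w' (by simp [hw'])) (i ::ₘ m) (by
      simp only [Multiset.card_cons] at hk ⊢; omega)
    rw [Multiset.map_cons, Multiset.prod_cons] at h
    convert h using 2
    ring

theorem jetFun_two_mem {A : Subalgebra ℝ (DiffFun n)}
    (hU : ∀ s : FibreIdx n, s.1.card ≤ 2 → uCoord s ∈ A) {a b : Fin n → DiffFun n}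
    (ha : ∀ i, a i ∈ A) (hb : ∀ i, b i ∈ A) : jetFun uCoord (linForm a * linForm b) ∈ A := by
  have h := jetFun_prod_mem hU {a, b} (by simp [ha, hb]) 0 (by simp)
  simpa using h

theorem jetFun_three_mem {A : Subalgebra ℝ (DiffFun n)}
    (hU : ∀ s : FibreIdx n, s.1.card ≤ 3 → uCoord s ∈ A) {a b c : Fin n → DiffFun n}
    (ha : ∀ i, a i ∈ A) (hb : ∀ i, b i ∈ A) (hc : ∀ i, c i ∈ A) :
    jetFun uCoord (linForm a * linForm b * linForm c) ∈ A := by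
  have h := jetFun_prod_mem hU {a, b, c} (by simp [ha, hb, hc]) 0 (by simp)
  simpa [mul_assoc] using h

theorem jetFun_four_mem {A : Subalgebra ℝ (DiffFun n)}
    (hU : ∀ s : FibreIdx n, s.1.card ≤ 4 → uCoord s ∈ A) {a b c d : Fin n → DiffFun n}
    (ha : ∀ i, a i ∈ A) (hb : ∀ i, b i ∈ A) (hc : ∀ i, c i ∈ A) (hd : ∀ i, d i ∈ A) :
    jetFun uCoord (linForm a * linForm b * linForm c * linForm d) ∈ A := by
  have h := jetFun_prod_mem hU {a, b, c, d} (by simp [ha, hb, hc, hd]) 0 (by simp)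
  simpa [mul_assoc] using h

/-- Quotients of polynomials with denominator of order at most `l` and numerator in `N`. -/
def quotAlg (l : ℕ) (N : Subalgebra (SmoothFun n) (JetPoly n))
    (hN : supported (SmoothFun n) {s : FibreIdx n | s.1.card ≤ l} ≤ N) :
    Subalgebra ℝ (DiffFun n) where
  carrier := {f | ∃ (P : JetPoly n) (Q : denoms n), f = quot P Q ∧ P ∈ N ∧
    (Q : JetPoly n) ∈ supported (SmoothFun n) {s : FibreIdx n | s.1.card ≤ l}}
  mul_mem' := by
    rintro f f' ⟨P, Q, rfl, hP, hQ⟩ ⟨P', Q', rfl, hP', hQ'⟩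
    exact ⟨_, _, quot_mul_quot P P' Q Q', mul_mem hP hP', mul_mem hQ hQ'⟩
  add_mem' := by
    rintro f f' ⟨P, Q, rfl, hP, hQ⟩ ⟨P', Q', rfl, hP', hQ'⟩
    exact ⟨_, _, quot_add_quot P P' Q Q', add_mem (mul_mem hP (hN hQ')) (mul_mem hP' (hN hQ)),
      mul_mem hQ hQ'⟩
  algebraMap_mem' c := by
    refine ⟨algebraMap ℝ (JetPoly n) c, 1, ?_, ?_, one_mem _⟩
    · rw [quot_one]; rfl
    · rw [IsScalarTower.algebraMap_apply ℝ (SmoothFun n) (JetPoly n)]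
      exact N.algebraMap_mem _

/-- Quotients of polynomials of order at most `l`. -/
def ratOrder (n l : ℕ) : Subalgebra ℝ (DiffFun n) := quotAlg l _ le_rfl

/-- Quotients of polynomials with denominator of order at most `l`. -/
def polyAbove (n l : ℕ) : Subalgebra ℝ (DiffFun n) := quotAlg l ⊤ le_top

theorem mem_polyAbove {l : ℕ} {f : DiffFun n} : f ∈ polyAbove n l ↔ IsPolynomialAbove l f := by
  constructor
  · rintro ⟨P, Q, rfl, -, hQ⟩
    exact ⟨P, Q, rfl, fun s hs => mem_supported.1 hQ hs⟩
  · rintro ⟨P, Q, rfl, hQ⟩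
    exact ⟨P, Q, rfl, Algebra.mem_top, mem_supported.2 fun s hs => hQ s hs⟩

theorem ratOrder_le_polyAbove (n l : ℕ) : ratOrder n l ≤ polyAbove n l := by
  rintro f ⟨P, Q, rfl, -, hQ⟩
  exact ⟨P, Q, rfl, Algebra.mem_top, hQ⟩

theorem algebraMap_mem_polyAbove (l : ℕ) (P : JetPoly n) :
    algebraMap (JetPoly n) (DiffFun n) P ∈ polyAbove n l :=
  ⟨P, 1, (quot_one P).symm, Algebra.mem_top, one_mem _⟩

theorem uCoord_mem_ratOrder {l : ℕ} (s : FibreIdx n) (hs : s.1.card ≤ l) :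
    uCoord s ∈ ratOrder n l :=
  ⟨X s, 1, (quot_one _).symm, Algebra.subset_adjoin ⟨s, hs, rfl⟩, one_mem _⟩

/-- Inverting exchanges numerator and denominator, so the order of both has to be bounded here. -/
theorem invClosed_ratOrder (n l : ℕ) : InvClosed (ratOrder n l) := by
  rintro f ⟨P, Q, rfl, hP, hQ⟩ h e
  obtain ⟨hP', rfl⟩ := mem_denoms_of_quot_mul_eq_one e
  exact ⟨_, _, rfl, hQ, hP⟩

theorem mulVec_mem {A : Subalgebra ℝ (DiffFun n)} {M : Matrix (Fin n) (Fin n) (DiffFun n)}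
    (hM : ∀ i j, M i j ∈ A) {w : Fin n → DiffFun n} (hw : ∀ i, w i ∈ A) (i : Fin n) :
    (M *ᵥ w) i ∈ A := by
  change ∑ j, M i j * w j ∈ A
  exact sum_mem fun j _ => mul_mem (hM i j) (hw j)

theorem single_mem {A : Subalgebra ℝ (DiffFun n)} (i j : Fin n) :
    (Pi.single i 1 : Fin n → DiffFun n) j ∈ A := by
  rw [Pi.single_apply]
  split_ifs
  · exact one_mem _
  · exact zero_mem _

theorem hessOf_inv_mem_ratOrder {l : ℕ} (hl : 2 ≤ l) (i j : Fin n) :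
    (hessOf (uCoord (n := n)))⁻¹ i j ∈ ratOrder n l := by
  refine matrix_inv_mem (invClosed_ratOrder n l) (fun a b => ?_) isUnit_det_hessOf_uCoord i j
  have h := jetFun_two_mem (A := ratOrder n l)
    (fun s hs => uCoord_mem_ratOrder s (hs.trans hl)) (single_mem a) (single_mem b)
  simpa [hessOf] using h

/-- The field v_1 uses λ and h, and A adds u_3; no power of A raises the order further. -/
theorem fvec_mem_ratOrder (i j : Fin n) : fvec i j ∈ ratOrder n 3 := by
  have h1 : ∀ i, vOneOf (uCoord (n := n)) i ∈ ratOrder n 3 := by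
    refine mulVec_mem (hessOf_inv_mem_ratOrder (by norm_num)) fun i => ?_
    rw [← lam_eq_lamOf]
    exact uCoord_mem_ratOrder _ (by simp)
  have h2 : ∀ w : Fin n → DiffFun n, (∀ i, w i ∈ ratOrder n 3) →
      ∀ i, (endoOf uCoord *ᵥ w) i ∈ ratOrder n 3 := by
    intro w hw
    rw [endoOf, ← Matrix.mulVec_mulVec]
    refine mulVec_mem (hessOf_inv_mem_ratOrder (by norm_num)) (mulVec_mem (fun a b => neg_mem ?_) hw)
    have h := jetFun_three_mem (A := ratOrder n 3) uCoord_mem_ratOrder h1 (single_mem a)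
      (single_mem b)
    simpa using h
  have h3 : ∀ (k : ℕ) (i : Fin n), ((endoOf uCoord ^ k) *ᵥ vOneOf uCoord) i ∈ ratOrder n 3 := by
    intro k
    induction k with
    | zero => simpa using h1
    | succ k ih => rw [pow_succ', ← Matrix.mulVec_mulVec]; exact h2 _ ih
  exact h3 i j

theorem gensThree_subset_ratOrder [NeZero n] : gensThree n ⊆ ratOrder n 3 := by
  have hv := fvec_mem_ratOrder (n := n)
  rintro f (rfl | ⟨τ, rfl⟩)
  · rw [sigmaFrame, sigma_two]
    simp only [frame_eq]
    exact jetFun_two_mem (fun s hs => uCoord_mem_ratOrder s (hs.trans (by norm_num))) (hv _) (hv _)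
  · rw [sigmaFrame, sigma_three]
    simp only [frame_eq]
    exact neg_mem (jetFun_three_mem uCoord_mem_ratOrder (hv _) (hv _) (hv _))

theorem gensFour_subset_polyAbove : gensFour n ⊆ polyAbove n 3 := by
  have hu : ∀ s : FibreIdx n, uCoord s ∈ polyAbove n 3 := fun s => algebraMap_mem_polyAbove 3 _
  have hv := fun i j : Fin n => ratOrder_le_polyAbove n 3 (fvec_mem_ratOrder i j)
  rintro f ⟨τ, rfl⟩
  rw [sigmaFrame, sigma_four]
  simp only [frame_eq]
  have hc : ∀ i j k : Fin n, crossVec (fvec i) (fvec j) k ∈ polyAbove n 3 := by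
    intro i j
    refine mulVec_mem (fun a b => ratOrder_le_polyAbove n 3
      (hessOf_inv_mem_ratOrder (by norm_num) a b)) fun k => ?_
    have h := jetFun_three_mem (fun s _ => hu s) (hv i) (hv j) (single_mem k)
    simpa using h
  have h2 := fun i j : Fin n => jetFun_two_mem (fun s _ => hu s) (hv i) (hv j)
  have h3 := fun (a b c : Fin n → DiffFun n) => jetFun_three_mem (a := a) (b := b) (c := c)
    (fun s _ => hu s)
  exact add_mem (add_mem (add_mem (sub_mem (add_mem (add_mem
    (h3 _ _ _ (hc _ _) (hv _) (hv _)) (h3 _ _ _ (hv _) (hc _ _) (hv _)))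
    (h3 _ _ _ (hv _) (hv _) (hc _ _)))
    (jetFun_four_mem (fun s _ => hu s) (hv _) (hv _) (hv _) (hv _)))
    (mul_mem (h2 _ _) (h2 _ _))) (mul_mem (h2 _ _) (h2 _ _))) (mul_mem (h2 _ _) (h2 _ _))

theorem totalD_algebraMap_mem (j : Fin n) (P : JetPoly n) (l : ℕ) :
    totalD j (algebraMap (JetPoly n) (DiffFun n) P) ∈ polyAbove n l := by
  induction P using MvPolynomial.induction_on with
  | C a =>
    have h : ∀ b : SmoothFun n, algebraMap (JetPoly n) (DiffFun n) (C b) = ofSmooth b := fun _ => rfl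
    rw [h, totalD_ofSmooth, ← h]
    exact algebraMap_mem_polyAbove l _
  | add P Q hP hQ => rw [map_add, map_add]; exact add_mem hP hQ
  | mul_X P s hP =>
    have h : ∀ s : FibreIdx n, algebraMap (JetPoly n) (DiffFun n) (X s) = uCoord s := fun _ => rfl
    rw [map_mul, Derivation.leibniz, h, totalD_uCoord, ← h, ← h, smul_eq_mul, smul_eq_mul]
    exact add_mem (mul_mem (algebraMap_mem_polyAbove l _) (algebraMap_mem_polyAbove l _))
      (mul_mem (algebraMap_mem_polyAbove l _) hP)

theorem totalD_mem_polyAbove (j : Fin n) {l : ℕ} {f : DiffFun n} (hf : f ∈ polyAbove n l) :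
    totalD j f ∈ polyAbove n l := by
  have hf' := hf
  obtain ⟨P, Q, rfl, -, hQ⟩ := hf
  have h1 : algebraMap (JetPoly n) (DiffFun n) P =
      quot P Q * algebraMap (JetPoly n) (DiffFun n) Q := (IsLocalization.mk'_spec _ _ _).symm
  have h2 : algebraMap (JetPoly n) (DiffFun n) Q * quot 1 Q = 1 := by
    rw [← quot_one, quot_mul_quot, ← quot_self 1, quot_eq_quot_iff]
    simp
  have h3 := congrArg (totalD j) h1
  rw [Derivation.leibniz, smul_eq_mul, smul_eq_mul] at h3
  -- The quotient rule: D(P/Q) divides only by powers of Q, so derivatives of higher order enter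
  -- polynomially.
  have h4 : totalD j (quot P Q) = (totalD j (algebraMap (JetPoly n) (DiffFun n) P) -
      quot P Q * totalD j (algebraMap (JetPoly n) (DiffFun n) Q)) * quot 1 Q := by
    rw [h3]
    linear_combination -totalD j (quot P Q) * h2
  rw [h4]
  exact mul_mem (sub_mem (totalD_algebraMap_mem j P l)
    (mul_mem hf' (totalD_algebraMap_mem j Q l))) ⟨1, Q, rfl, Algebra.mem_top, hQ⟩

theorem frameClosed_polyAbove : FrameClosed (polyAbove n 3) := by
  intro f hf i
  rw [frameD_eq]
  exact sum_mem fun j _ => mul_mem (ratOrder_le_polyAbove n 3 (fvec_mem_ratOrder i j))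
    (totalD_mem_polyAbove j hf)

/-! ### Invariants as functions of the components in the frame -/

/-- Polynomials in the fibre coordinates with constant coefficients. -/
abbrev ConstPoly (n : ℕ) : Type := MvPolynomial (FibreIdx n) ℝ

/-- A polynomial with constant coefficients as a polynomial with smooth coefficients. -/
def ofConst : ConstPoly n →+* JetPoly n := map (algebraMap ℝ (SmoothFun n))

theorem map_evalAt_ofConst (x : Fin n → ℝ) (P : ConstPoly n) :
    map (evalAt x) (ofConst P) = P := by
  rw [ofConst, map_map]
  have h : (evalAt x).comp (algebraMap ℝ (SmoothFun n)) = RingHom.id ℝ := RingHom.ext fun _ => rfl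
  rw [h, map_id]

theorem evalJet_ofConst (θ : JetPoint n) (P : ConstPoly n) :
    evalJet θ (ofConst P) = eval θ.fibre P := by
  rw [evalJet_eq_eval, map_evalAt_ofConst]

theorem ofConst_mem_denoms {Q : ConstPoly n} (hQ : Q ≠ 0) : ofConst Q ∈ denoms n := fun x => by
  rwa [map_evalAt_ofConst]

/-- The denominator given by a nonzero polynomial with constant coefficients. -/
def constDenom (Q : ConstPoly n) (hQ : Q ≠ 0) : denoms n := ⟨ofConst Q, ofConst_mem_denoms hQ⟩

theorem evalJet_constDenom (θ : JetPoint n) (Q : ConstPoly n) (hQ : Q ≠ 0) :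
    evalJet θ (constDenom Q hQ : JetPoly n) = eval θ.fibre Q := evalJet_ofConst θ Q

/-- Invariance under translations: a differential invariant does not depend on `x`. -/
theorem IsDiffInvariant.quot_eq_const {P : JetPoly n} {Q : denoms n}
    (h : IsDiffInvariant (quot P Q)) : quot P Q =
      quot (ofConst (map (evalAt 0) P)) (constDenom (map (evalAt 0) (Q : JetPoly n)) (Q.2 0)) := by
  rw [quot_eq_quot_iff]
  refine jetPoly_ext_of_evalJet (Q * constDenom _ (Q.2 0)) fun θ hθ => ?_
  rw [Submonoid.coe_mul, evalJet_mul] at hθ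
  have h1 := left_ne_zero_of_mul hθ
  have h2 := right_ne_zero_of_mul hθ
  obtain ⟨g, hg, hx⟩ := exists_aff (B := (1 : Matrix (Fin n) (Fin n) ℝ)) (by simp) θ.x 0
  have hact : ∀ P : JetPoly n, evalJet (θ.act g) P = eval θ.fibre (map (evalAt 0) P) := by
    intro P
    rw [evalJet_eq_eval, act_fibre, hg, substJet_one, act_x, hx]
  rw [evalJet_constDenom, ← hact] at h2
  have := h g θ _ _ ⟨P, Q, rfl, h2, rfl⟩ ⟨P, Q, rfl, h1, rfl⟩
  rw [evalJet_mul, evalJet_mul, evalJet_constDenom, evalJet_ofConst, ← hact, ← hact]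
  rw [div_eq_div_iff h2 h1] at this
  linear_combination -this

/-- The invariance of a quotient as an identity between values. -/
theorem IsDiffInvariant.eval_mul_eval {P Q : ConstPoly n} {hQ : Q ≠ 0}
    (h : IsDiffInvariant (quot (ofConst P) (constDenom Q hQ))) (u : FibreIdx n → ℝ)
    {B : Matrix (Fin n) (Fin n) ℝ} (hB : IsUnit B.det) :
    eval (substJet u B) P * eval u Q = eval u P * eval (substJet u B) Q := by
  obtain ⟨g, hg, -⟩ := exists_aff hB 0 0
  have e := isDiffInvariant_iff.1 h g
  rw [pull_quot, quot_eq_quot_iff] at e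
  have e2 := congrArg (evalJet (jetPoint 0 u)) e
  simp only [evalJet_mul, evalJet_pullPoly, constDenom, evalJet_ofConst, act_fibre, hg,
    jetPoint_fibre] at e2
  exact e2

/-- The linear change of the fibre coordinates given by a matrix. -/
def substPoly (B : Matrix (Fin n) (Fin n) ℝ) : ConstPoly n →ₐ[ℝ] ConstPoly n :=
  aeval (substJet X (B.map (algebraMap ℝ (ConstPoly n))))

theorem eval_substPoly (u : FibreIdx n → ℝ) (B : Matrix (Fin n) (Fin n) ℝ) (P : ConstPoly n) :
    eval u (substPoly B P) = eval (substJet u B) P := by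
  have h : (aeval u).comp (substPoly B) = aeval (R := ℝ) (substJet u B) := by
    refine MvPolynomial.algHom_ext fun s => ?_
    rw [AlgHom.comp_apply, substPoly, aeval_X, aeval_X]
    have h1 := congrFun (map_substJet (eval u) X (B.map (algebraMap ℝ (ConstPoly n)))) s
    have h2 : eval u ∘ (X : FibreIdx n → ConstPoly n) = u := by funext s; simp
    have h3 : (B.map (algebraMap ℝ (ConstPoly n))).map (eval u) = B := by ext i j; simp
    rw [h2, h3] at h1
    exact h1
  have h' := congrArg (fun φ : ConstPoly n →ₐ[ℝ] ℝ => φ P) h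
  exact h'

/-- A change of frame mixes only coordinates of the same order, hence respects bounds on the order.
-/
theorem colProd_form_mem {R : Type*} [CommRing R] [Algebra ℝ R] {A : Subalgebra ℝ R}
    {U : FibreIdx n → R} {k : ℕ} (hU : ∀ s : FibreIdx n, s.1.card ≤ k → U s ∈ A)
    {B : Matrix (Fin n) (Fin n) R} (hB : ∀ i j, B i j ∈ A) (s : FibreIdx n) (hs : s.1.card ≤ k) :
    substJet U B s ∈ A := by
  have h := jetFun_prod_mem hU (s.1.map B.col) (by
    intro w hw
    obtain ⟨i, -, rfl⟩ := Multiset.mem_map.1 hw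
    exact fun j => hB j i) 0 (by simpa using hs)
  simpa [Multiset.map_map, Function.comp_def, substJet, colProd] using h

theorem aeval_mem_of_supported {A : Type*} [CommRing A] [Algebra ℝ A] {σ : Type*} {t : Set σ}
    {S : Subalgebra ℝ A} {v : σ → A} (hv : ∀ s ∈ t, v s ∈ S) {P : MvPolynomial σ ℝ}
    (hP : P ∈ supported ℝ t) : aeval v P ∈ S := by
  have h : supported ℝ t ≤ S.comap (aeval v) := by
    refine Algebra.adjoin_le ?_
    rintro _ ⟨s, hs, rfl⟩
    change aeval v (X s) ∈ S
    rw [aeval_X]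
    exact hv s hs
  exact h hP

theorem substPoly_mem_supported (B : Matrix (Fin n) (Fin n) ℝ) {k : ℕ} {P : ConstPoly n}
    (hP : P ∈ supported ℝ {s : FibreIdx n | s.1.card ≤ k}) :
    substPoly B P ∈ supported ℝ {s : FibreIdx n | s.1.card ≤ k} :=
  aeval_mem_of_supported (fun s hs => colProd_form_mem
    (A := supported ℝ {s : FibreIdx n | s.1.card ≤ k}) (U := X)
    (fun _ hs' => Algebra.subset_adjoin (Set.mem_image_of_mem X hs'))
    (fun i j => Subalgebra.algebraMap_mem _ (B i j)) s hs) hP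

/-- The polynomial `P` in the components in the frame. -/
def frameEval : ConstPoly n →ₐ[ℝ] DiffFun n := aeval (substJet uCoord (frameOf uCoord))

/-- Both sides are projections of one element of the graph, the polynomial `P` in the frame
components formed there. -/
theorem hasValue_frameEval {θ : JetPoint n} (h : (hessOf θ.fibre).det ≠ 0) (P : ConstPoly n) :
    HasValue (frameEval P) θ (eval (substJet θ.fibre (frameOf θ.fibre)) P) := by
  let e : ConstPoly n →ₐ[ℝ] valueGraph θ := aeval (substJet (uGraph θ) (frameOf (uGraph θ)))
  have h1 : (valueGraph.fst θ).comp e = frameEval := by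
    refine MvPolynomial.algHom_ext fun s => ?_
    rw [AlgHom.comp_apply, frameEval, aeval_X, aeval_X]
    have := congrFun (map_substJet (valueGraph.fst θ : valueGraph θ →+* DiffFun n) (uGraph θ)
      (frameOf (uGraph θ))) s
    refine this.trans ?_
    rw [← frameOf_uGraph_fst h]
    rfl
  have h2 : (valueGraph.snd θ).comp e =
      aeval (R := ℝ) (substJet θ.fibre (frameOf θ.fibre)) := by
    refine MvPolynomial.algHom_ext fun s => ?_
    rw [AlgHom.comp_apply, aeval_X, aeval_X]
    have := congrFun (map_substJet (valueGraph.snd θ : valueGraph θ →+* ℝ) (uGraph θ)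
      (frameOf (uGraph θ))) s
    refine this.trans ?_
    rw [← frameOf_uGraph_snd h]
    rfl
  have hv := valueGraph.hasValue (e P)
  rw [← AlgHom.comp_apply, ← AlgHom.comp_apply, h1, h2] at hv
  exact hv

/-- A differential invariant is a quotient of polynomials in the components in the frame. The
order of the denominator does not increase. -/
theorem IsDiffInvariant.exists_frameEval {P : JetPoly n} {Q : denoms n}
    (hf : IsDiffInvariant (quot P Q)) : ∃ P₁ Q₁ : ConstPoly n, IsUnit (frameEval Q₁) ∧
      quot P Q * frameEval Q₁ = frameEval P₁ ∧
      ∀ k, (∀ s ∈ (Q : JetPoly n).vars, s.1.card ≤ k) →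
        Q₁ ∈ supported ℝ {s : FibreIdx n | s.1.card ≤ k} := by
  set P₀ : ConstPoly n := map (evalAt 0) P
  set Q₀ : ConstPoly n := map (evalAt 0) (Q : JetPoly n)
  have hQ₀ : Q₀ ≠ 0 := Q.2 0
  have hf₀ : quot P Q = quot (ofConst P₀) (constDenom Q₀ hQ₀) := hf.quot_eq_const
  obtain ⟨D, hD⟩ := exists_denom_frameOf (n := n)
  obtain ⟨u, hu⟩ := exists_evalJet_ne_zero (constDenom Q₀ hQ₀ * D) 0
  rw [Submonoid.coe_mul, evalJet_mul, evalJet_constDenom] at hu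
  obtain ⟨hdet, hfr⟩ := hD _ (right_ne_zero_of_mul hu)
  have hQu := left_ne_zero_of_mul hu
  rw [jetPoint_fibre] at hdet hfr hQu
  -- Jets written in their own frame are special, and `Q₀` might vanish on all of them. By
  -- invariance the quotient is unchanged when both polynomials are moved by a fixed matrix. With
  -- this `B`, the moved denominator takes the nonzero value `Q₀(u)` at the frame components of `u`.
  set B : Matrix (Fin n) (Fin n) ℝ := (frameOf u)⁻¹
  have hfrU : IsUnit (frameOf u).det := isUnit_iff_ne_zero.2 hfr
  have hB : IsUnit B.det := Matrix.isUnit_nonsing_inv_det _ hfrU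
  have hval : eval (substJet u (frameOf u)) (substPoly B Q₀) ≠ 0 := by
    rw [eval_substPoly, substJet_substJet, Matrix.mul_nonsing_inv _ hfrU, substJet_one]
    exact hQu
  have hQ₁ : substPoly B Q₀ ≠ 0 := by
    intro h
    rw [h, map_zero] at hval
    exact hval rfl
  have hf₁ : quot P Q = quot (ofConst (substPoly B P₀)) (constDenom (substPoly B Q₀) hQ₁) := by
    rw [hf₀, quot_eq_quot_iff]
    refine jetPoly_ext_of_evalJet 1 fun θ _ => ?_
    rw [evalJet_mul, evalJet_mul, evalJet_constDenom, evalJet_constDenom, evalJet_ofConst,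
      evalJet_ofConst, eval_substPoly, eval_substPoly]
    exact ((hf₀ ▸ hf).eval_mul_eval θ.fibre hB).symm
  -- Frame components do not depend on x, so the same `u` gives a nonzero value on every fibre.
  have hunit : IsUnit (frameEval (substPoly B Q₀)) := by
    refine isUnit_of_hasValue fun x => ⟨jetPoint x u, _, rfl,
      hasValue_frameEval (by rwa [jetPoint_fibre]) _, ?_⟩
    rwa [jetPoint_fibre]
  refine ⟨substPoly B P₀, substPoly B Q₀, hunit, ?_, fun k hk => ?_⟩
  -- At a generic jet the two sides agree by invariance under the change of basis to the frame of
  -- that jet.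
  · refine sub_eq_zero.1 (eq_zero_of_hasValue (constDenom _ hQ₁ * D) fun θ hθ => ?_)
    rw [Submonoid.coe_mul, evalJet_mul] at hθ
    have hq := left_ne_zero_of_mul hθ
    obtain ⟨hθ1, hθ2⟩ := hD θ (right_ne_zero_of_mul hθ)
    have hv : HasValue (quot P Q) θ _ := ⟨_, _, hf₁, hq, rfl⟩
    have h := (hv.mul (hasValue_frameEval hθ1 (substPoly B Q₀))).sub
      (hasValue_frameEval hθ1 (substPoly B P₀))
    have hi := (hf₁ ▸ hf).eval_mul_eval θ.fibre (isUnit_iff_ne_zero.2 hθ2)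
    rw [evalJet_constDenom] at h hq
    rw [evalJet_ofConst, div_mul_eq_mul_div, ← hi, mul_div_assoc, div_self hq, mul_one,
      sub_self] at h
    exact h
  · refine substPoly_mem_supported B (mem_supported.2 fun s hs => hk s ?_)
    exact vars_map _ _ hs

/-! ### Generation -/

theorem subset_ratGen (G : Set (DiffFun n)) : G ⊆ ratGen G := fun _ hf =>
  Algebra.mem_sInf.2 fun _ hB => hB.1 hf

theorem ratGen_le {G : Set (DiffFun n)} {B : Subalgebra ℝ (DiffFun n)} (hG : G ⊆ B)
    (hB : InvClosed B) : ratGen G ≤ B := sInf_le ⟨hG, hB⟩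

theorem invClosed_ratGen (G : Set (DiffFun n)) : InvClosed (ratGen G) := fun f hf h e =>
  Algebra.mem_sInf.2 fun B hB => hB.2 f (Algebra.mem_sInf.1 hf B hB) h e

theorem subset_diffAlgGen (G : Set (DiffFun n)) : G ⊆ diffAlgGen G := fun _ hf =>
  Algebra.mem_sInf.2 fun _ hB => hB.1 hf

theorem diffAlgGen_le {G : Set (DiffFun n)} {B : Subalgebra ℝ (DiffFun n)} (hG : G ⊆ B)
    (hB : FrameClosed B) : diffAlgGen G ≤ B := sInf_le ⟨hG, hB⟩

theorem frameClosed_diffAlgGen (G : Set (DiffFun n)) : FrameClosed (diffAlgGen G) :=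
  fun f hf i => Algebra.mem_sInf.2 fun B hB => hB.2 f (Algebra.mem_sInf.1 hf B hB) i

theorem subset_diffFieldGen (G : Set (DiffFun n)) : G ⊆ diffFieldGen G := fun _ hf =>
  Algebra.mem_sInf.2 fun _ hB => hB.1 hf

theorem diffFieldGen_le {G : Set (DiffFun n)} {B : Subalgebra ℝ (DiffFun n)} (hG : G ⊆ B)
    (hB : InvClosed B) (hB' : FrameClosed B) : diffFieldGen G ≤ B := sInf_le ⟨hG, hB, hB'⟩

theorem invClosed_diffFieldGen (G : Set (DiffFun n)) : InvClosed (diffFieldGen G) :=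
  fun f hf h e => Algebra.mem_sInf.2 fun B hB => hB.2.1 f (Algebra.mem_sInf.1 hf B hB) h e

theorem frameClosed_diffFieldGen (G : Set (DiffFun n)) : FrameClosed (diffFieldGen G) :=
  fun f hf i => Algebra.mem_sInf.2 fun B hB => hB.2.2 f (Algebra.mem_sInf.1 hf B hB) i

/-! ### The two generation theorems -/

section generation

variable [NeZero n] {B B' : Subalgebra ℝ (DiffFun n)}

theorem frameEval_mem (hB : gensThree n ⊆ B) (hI : InvClosed B) (hle : B ≤ B')
    (h4 : gensFour n ⊆ B') (hD : FrameClosed B') (P : ConstPoly n) : frameEval P ∈ B' := by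
  refine aeval_mem_of_supported (t := Set.univ) (fun s _ => ?_) (by simp)
  exact jetFun_mem_of_framePoly_of_frameClosed hB hI hle h4 hD (colProd_mem_framePoly B' s.1)

theorem frameEval_mem_of_supported (hB : gensThree n ⊆ B) {P : ConstPoly n}
    (hP : P ∈ supported ℝ {s : FibreIdx n | s.1.card ≤ 3}) : frameEval P ∈ B :=
  aeval_mem_of_supported (fun s hs =>
    jetFun_mem_of_framePoly_le_three hB hs (colProd_mem_framePoly B s.1)) hP

theorem isDiffInvariant_iff_mem_diffFieldGen (f : DiffFun n) :
    IsDiffInvariant f ↔ f ∈ diffFieldGen (gensThree n ∪ gensFour n) := by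
  constructor
  · intro hf
    obtain ⟨P, Q, rfl⟩ := exists_eq_quot f
    obtain ⟨P₁, Q₁, hunit, e, -⟩ := hf.exists_frameEval
    have hsub := subset_diffFieldGen (gensThree n ∪ gensFour n)
    have hI := invClosed_diffFieldGen (gensThree n ∪ gensFour n)
    have hmem := frameEval_mem (Set.subset_union_left.trans hsub) hI le_rfl
      (Set.subset_union_right.trans hsub) (frameClosed_diffFieldGen _)
    obtain ⟨h, hh⟩ := hunit.exists_right_inv
    have hf' : quot P Q = frameEval P₁ * h := by rw [← e, mul_assoc, hh, mul_one]
    rw [hf']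
    exact mul_mem (hmem P₁) (hI _ (hmem Q₁) h hh)
  · intro hf
    exact mem_invariants.1 (diffFieldGen_le (Set.union_subset gensThree_subset_invariants
      gensFour_subset_invariants) invClosed_invariants frameClosed_invariants hf)

/-- A denominator of order at most three becomes a polynomial in frame components of order at most
three, whose inverse is already in `ratGen (gensThree n)`; the numerator needs only the derivations.
Conversely, invariance and polynomiality above order three hold for the generators and persist under
the v_i. -/
theorem isPolynomialAbove_iff_mem_diffAlgGen (f : DiffFun n) :
    IsDiffInvariant f ∧ IsPolynomialAbove 3 f ↔
      f ∈ diffAlgGen ((ratGen (gensThree n) : Set (DiffFun n)) ∪ gensFour n) := by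
  constructor
  · rintro ⟨hf, P, Q, rfl, hQ⟩
    obtain ⟨P₁, Q₁, hunit, e, hQ₁⟩ := hf.exists_frameEval
    have hsub := subset_diffAlgGen ((ratGen (gensThree n) : Set (DiffFun n)) ∪ gensFour n)
    have h3 := subset_ratGen (gensThree n)
    have hI := invClosed_ratGen (gensThree n)
    have hle : ratGen (gensThree n) ≤ diffAlgGen ((ratGen (gensThree n) : Set (DiffFun n)) ∪
      gensFour n) := Set.subset_union_left.trans hsub
    obtain ⟨h, hh⟩ := hunit.exists_right_inv
    have hf' : quot P Q = frameEval P₁ * h := by rw [← e, mul_assoc, hh, mul_one]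
    rw [hf']
    exact mul_mem (frameEval_mem h3 hI hle (Set.subset_union_right.trans hsub)
      (frameClosed_diffAlgGen _) P₁)
      (hle (hI _ (frameEval_mem_of_supported h3 (hQ₁ 3 hQ)) h hh))
  · intro hf
    constructor
    · exact mem_invariants.1 (diffAlgGen_le (Set.union_subset
        (ratGen_le gensThree_subset_invariants invClosed_invariants)
        gensFour_subset_invariants) frameClosed_invariants hf)
    · exact mem_polyAbove.1 (diffAlgGen_le (Set.union_subset
        ((ratGen_le gensThree_subset_ratOrder (invClosed_ratOrder n 3)).trans
          (ratOrder_le_polyAbove n 3))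
        gensFour_subset_polyAbove) frameClosed_polyAbove hf)

end generation

end AffInv

end

theorem mainTheorem2 (n : ℕ) [NeZero n] :
    -- v₁, …, vₙ are invariant derivations
    (∀ (i : Fin n) (g : AffInv.Aff n) (f f' : AffInv.DiffFun n),
      AffInv.IsPullback g f f' →
        AffInv.IsPullback g (AffInv.frameD i f) (AffInv.frameD i f')) ∧
    -- the field of differential invariants
    {f : AffInv.DiffFun n | AffInv.IsDiffInvariant f} =
      (AffInv.diffFieldGen (AffInv.gensThree n ∪ AffInv.gensFour n) : Set (AffInv.DiffFun n)) ∧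
    -- the algebra of differential invariants polynomial in the derivatives of order above three
    {f : AffInv.DiffFun n | AffInv.IsDiffInvariant f ∧ AffInv.IsPolynomialAbove 3 f} =
      (AffInv.diffAlgGen ((AffInv.ratGen (AffInv.gensThree n) : Set (AffInv.DiffFun n)) ∪
        AffInv.gensFour n) : Set (AffInv.DiffFun n)) := by
  refine ⟨fun i g f f' h => ?_, Set.ext AffInv.isDiffInvariant_iff_mem_diffFieldGen,
    Set.ext AffInv.isPolynomialAbove_iff_mem_diffAlgGen⟩
  rw [AffInv.isPullback_iff] at h ⊢
  rw [AffInv.pull_frameD, h]
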